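/- Let $\ell^\infty(\mathbb N)$ be the C*-algebra of bounded functions $f:\mathbb N\to\mathbb C$, $\mathbb N=\{0,1,2,\dots\}$, and let $(\sigma f)(n)=f(n+1)$. An \emph{anqie} is a unital C*-subalgebra $\mathcal A\subseteq\ell^\infty(\mathbb N)$ with $\sigma(\mathcal A)\subseteq\mathcal A$. Its \emph{anqie entropy} is the topological entropy (defined by open covers) of the continuous map $\rho\mapsto\rho\circ\sigma$ on the maximal ideal space of $\mathcal A$, i.e. on the compact space of multiplicative states of $\mathcal A$ with the weak* topology. The anqie entropy of $f\in\ell^\infty(\mathbb N)$ is that of the smallest anqie containing $f$. Let $\mathcal E_0(\mathbb N)$ be the set of all $f\in\ell^\infty(\mathbb N)$ with anqie entropy $0$. For a unital C*-algebra $A$, let $\mathcal P_\infty(A)$ be the disjoint union over $k\ge 1$ of the sets of projections $p=p^2=p^*$ in $M_k(A)$. Write $p\sim_0 q$, for projections $p\in M_k(A)$ and $q\in M_l(A)$, if $p=u^*u$ and $q=uu^*$ for some $l\times k$ matrix $u$ over $A$. Then $\mathcal D(A)=\mathcal P_\infty(A)/\!\sim_0$ is an abelian semigroup under $[p]+[q]=[\operatorname{diag}(p,q)]$,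 and $K_0(A)$ is its Grothendieck group. \textbf{Theorem.} The set $\mathcal E_0(\mathbb N)$ is a unital C*-subalgebra of $\ell^\infty(\mathbb N)$, and the group $K_0(\mathcal E_0(\mathbb N))$ is isomorphic to the additive group $\{f\in\mathcal E_0(\mathbb N): f(\mathbb N)\subseteq\mathbb Z\}$. -/

import Mathlib

open scoped Matrix BoundedContinuousFunction

noncomputable section

namespace Arith

/-! ### The C*-algebra of bounded arithmetic functions and its shift-invariant subalgebras -/

/-- The C*-algebra `ℓ^∞(ℕ)` of bounded complex-valued functions on `ℕ = {0, 1, 2, …}` with pointwise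
operations and the supremum norm (`ℕ` is discrete, so continuity is no restriction). -/
abbrev LInfty : Type := ℕ →ᵇ ℂ

/-- The shift `(σ f)(n) = f (n + 1)` on `ℓ^∞(ℕ)`. -/
def shift : LInfty →⋆ₐ[ℂ] LInfty where
  toFun f := f.compContinuous ⟨fun n => n + 1, continuous_of_discreteTopology⟩
  map_one' := rfl
  map_mul' _ _ := rfl
  map_zero' := rfl
  map_add' _ _ := rfl
  commutes' _ := rfl
  map_star' _ := rfl

@[simp] theorem shift_apply (f : LInfty) (n : ℕ) : shift f n = f (n + 1) := rfl

/-- An anqie of `ℕ`: a unital (norm closed) C*-subalgebra of `ℓ^∞(ℕ)` that is invariant under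
the shift. -/
structure Anqie where
  /-- the underlying unital star subalgebra -/
  alg : StarSubalgebra ℂ LInfty
  isClosed : IsClosed (alg : Set LInfty)
  shift_mem : ∀ f ∈ alg, shift f ∈ alg

/-- The anqie generated by a family `F` of bounded arithmetic functions: the smallest closed
shift-invariant unital star subalgebra of `ℓ^∞(ℕ)` that contains `F`. -/
def generatedAnqie (F : Set LInfty) : Anqie where
  alg := sInf {S : StarSubalgebra ℂ LInfty |
    IsClosed (S : Set LInfty) ∧ (∀ f ∈ S, shift f ∈ S) ∧ F ⊆ S}
  isClosed := by
    rw [StarSubalgebra.coe_sInf]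
    exact isClosed_biInter fun S hS => hS.1
  shift_mem f hf := by
    rw [StarSubalgebra.mem_sInf] at hf ⊢
    exact fun S hS => hS.2.1 f (hf S hS)

theorem subset_generatedAnqie (F : Set LInfty) : F ⊆ (generatedAnqie F).alg := by
  intro f hf
  exact StarSubalgebra.mem_sInf.mpr fun S hS => hS.2.2 hf

theorem generatedAnqie_le {F : Set LInfty} {A : Anqie} (h : F ⊆ A.alg) :
    (generatedAnqie F).alg ≤ A.alg :=
  sInf_le ⟨A.isClosed, A.shift_mem, h⟩

namespace Anqie

variable (A : Anqie)

instance : CompleteSpace A.alg := A.isClosed.completeSpace_coe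

/-- The maximal ideal space of an anqie: its multiplicative states, with the weak* topology. -/
abbrev Spectrum : Type := WeakDual.characterSpace ℂ A.alg

/-- The point evaluation `ι(n) : f ↦ f n`, as a multiplicative state. -/
def eval (n : ℕ) : A.Spectrum :=
  WeakDual.CharacterSpace.equivAlgHom.symm
    { toFun := fun f => (f : LInfty) n
      map_one' := rfl
      map_mul' := fun _ _ => rfl
      map_zero' := rfl
      map_add' := fun _ _ => rfl
      commutes' := fun _ => rfl }

/-- The shift as a star endomorphism of an anqie. -/
def shiftHom : A.alg →⋆ₐ[ℂ] A.alg :=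
  (shift.comp A.alg.subtype).codRestrict A.alg fun f => A.shift_mem f f.2

/-- The additive map `ρ ↦ ρ ∘ σ` on the maximal ideal space of an anqie. -/
def addMap : C(A.Spectrum, A.Spectrum) := WeakDual.CharacterSpace.compContinuousMap A.shiftHom

/-- The additive map extends the map `ι(n) ↦ ι(n + 1)`. -/
theorem addMap_eval (n : ℕ) : A.addMap (A.eval n) = A.eval (n + 1) := rfl

end Anqie

/-! ### Topological entropy through open covers -/

section Entropy

variable {X : Type*}

/-- `𝒰 ∨ T⁻¹ 𝒰 ∨ ⋯ ∨ T^{-(n-1)} 𝒰`: the sets `⋂_{i < n} T^{-i} U_i` with all `U_i` in `𝒰`. -/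
def iteratedCover (T : X → X) (𝒰 : Set (Set X)) (n : ℕ) : Set (Set X) :=
  {V | ∃ U : Fin n → Set X, (∀ i, U i ∈ 𝒰) ∧ V = ⋂ i : Fin n, (T^[i]) ⁻¹' (U i)}

/-- The minimal number of members of the cover `𝒰` that cover `X`. -/
def coverNumber (𝒰 : Set (Set X)) : ℕ :=
  sInf {k | ∃ s : Finset (Set X), (s : Set (Set X)) ⊆ 𝒰 ∧ ⋃₀ (s : Set (Set X)) = Set.univ ∧
    s.card = k}

/-- The entropy `h(T, 𝒰) = lim_n (1/n) log N(𝒰 ∨ ⋯ ∨ T^{-(n-1)} 𝒰)` of `T` with respect to a cover.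
For a continuous map of a compact space and an open cover the sequence `log N` is subadditive,
so the limit exists and equals the upper limit. -/
def coverEntropy (T : X → X) (𝒰 : Set (Set X)) : EReal :=
  Filter.limsup (fun n : ℕ => ((Real.log (coverNumber (iteratedCover T 𝒰 n)) / n : ℝ) : EReal))
    Filter.atTop

/-- The topological entropy of a continuous self-map of a compact space: the supremum of
`h(T, 𝒰)` over all open covers `𝒰`. -/
def topEntropy [TopologicalSpace X] [CompactSpace X] (T : C(X, X)) : EReal :=
  ⨆ 𝒰 ∈ {𝒰 : Set (Set X) | (∀ U ∈ 𝒰, IsOpen U) ∧ ⋃₀ 𝒰 = Set.univ}, coverEntropy T 𝒰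

end Entropy

/-- The anqie entropy of an anqie: the topological entropy of the additive map on its maximal
ideal space. -/
def Anqie.entropy (A : Anqie) : EReal := topEntropy A.addMap

/-- The anqie entropy of a bounded arithmetic function: the entropy of the anqie it generates. -/
def anqieEntropy (f : LInfty) : EReal := (generatedAnqie {f}).entropy

/-! ### The `K₀`-group of a unital ring with involution -/

section MurrayVonNeumann

variable {A : Type*} [Ring A] [StarRing A]

/-- Murray–von Neumann equivalence of square matrices `p`, `q` (possibly of different sizes):
`p = u* u` and `q = u u*` for a rectangular matrix `u`. -/
def MvN {m n : Type*} [Fintype m] [Fintype n] (p : Matrix m m A) (q : Matrix n n A) : Prop :=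
  ∃ u : Matrix n m A, uᴴ * u = p ∧ u * uᴴ = q

namespace MvN

variable {m n l m' n' : Type*} [Fintype m] [Fintype n] [Fintype l] [Fintype m'] [Fintype n']
variable {p : Matrix m m A} {q : Matrix n n A} {r : Matrix l l A}

theorem refl (hp : IsStarProjection p) : MvN p p := by
  have h : pᴴ = p := hp.isSelfAdjoint
  exact ⟨p, by rw [h]; exact hp.isIdempotentElem, by rw [h]; exact hp.isIdempotentElem⟩

theorem symm (h : MvN p q) : MvN q p := by
  obtain ⟨u, h1, h2⟩ := h
  exact ⟨uᴴ, by simpa using h2, by simpa using h1⟩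

theorem trans (hp : IsStarProjection p) (hr : IsStarProjection r) (h : MvN p q) (h' : MvN q r) :
    MvN p r := by
  obtain ⟨u, h1, h2⟩ := h
  obtain ⟨v, h3, h4⟩ := h'
  refine ⟨v * u, ?_, ?_⟩
  · calc (v * u)ᴴ * (v * u) = uᴴ * (vᴴ * v) * u := by
          simp only [Matrix.conjTranspose_mul, Matrix.mul_assoc]
      _ = (uᴴ * u) * (uᴴ * u) := by rw [h3, ← h2]; simp only [Matrix.mul_assoc]
      _ = p := by rw [h1]; exact hp.isIdempotentElem
  · calc (v * u) * (v * u)ᴴ = v * (u * uᴴ) * vᴴ := by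
          simp only [Matrix.conjTranspose_mul, Matrix.mul_assoc]
      _ = (v * vᴴ) * (v * vᴴ) := by rw [h2, ← h3]; simp only [Matrix.mul_assoc]
      _ = r := by rw [h4]; exact hr.isIdempotentElem

theorem submatrix (hp : IsStarProjection p) (e : n ≃ m) : MvN p (p.submatrix e e) := by
  have h : pᴴ = p := hp.isSelfAdjoint
  have h' : p * p = p := hp.isIdempotentElem
  refine ⟨p.submatrix e id, ?_, ?_⟩
  · rw [Matrix.conjTranspose_submatrix, h, Matrix.submatrix_mul_equiv p p id e id, h']
    rfl
  · rw [Matrix.conjTranspose_submatrix, h]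
    rw [← Matrix.submatrix_mul p p e id e Function.bijective_id, h']

theorem fromBlocks {p' : Matrix m' m' A} {q' : Matrix n' n' A} (h : MvN p q) (h' : MvN p' q') :
    MvN (Matrix.fromBlocks p 0 0 p') (Matrix.fromBlocks q 0 0 q') := by
  obtain ⟨u, rfl, rfl⟩ := h
  obtain ⟨v, rfl, rfl⟩ := h'
  refine ⟨Matrix.fromBlocks u 0 0 v, ?_, ?_⟩ <;>
    simp [Matrix.fromBlocks_conjTranspose, Matrix.fromBlocks_multiply]

end MvN

theorem isStarProjection_fromBlocks {m n : Type*} [Fintype m] [Fintype n] {p : Matrix m m A}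
    {q : Matrix n n A} (hp : IsStarProjection p) (hq : IsStarProjection q) :
    IsStarProjection (Matrix.fromBlocks p 0 0 q) := by
  have h1 : p * p = p := hp.isIdempotentElem
  have h2 : q * q = q := hq.isIdempotentElem
  have h3 : pᴴ = p := hp.isSelfAdjoint
  have h4 : qᴴ = q := hq.isSelfAdjoint
  refine ⟨?_, ?_⟩
  · change _ * _ = _
    simp [Matrix.fromBlocks_multiply, h1, h2]
  · change (Matrix.fromBlocks p 0 0 q)ᴴ = _
    simp [Matrix.fromBlocks_conjTranspose, h3, h4]

theorem isStarProjection_submatrix {m n : Type*} [Fintype m] [Fintype n] {p : Matrix m m A}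
    (hp : IsStarProjection p) (e : n ≃ m) : IsStarProjection (p.submatrix e e) := by
  have h1 : p * p = p := hp.isIdempotentElem
  have h3 : pᴴ = p := hp.isSelfAdjoint
  refine ⟨?_, ?_⟩
  · change _ * _ = _
    rw [Matrix.submatrix_mul_equiv, h1]
  · change (p.submatrix e e)ᴴ = _
    rw [Matrix.conjTranspose_submatrix, h3]

end MurrayVonNeumann

section KZero

variable (A : Type*) [Ring A] [StarRing A]

/-- `𝒫_∞(A)`: the disjoint union over `k ≥ 1` of the sets of projections in `M_k(A)`. -/
structure MatrixProjection where
  /-- the size of the matrix -/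
  size : ℕ
  size_pos : 0 < size
  /-- the matrix -/
  mat : Matrix (Fin size) (Fin size) A
  isStarProjection : IsStarProjection mat

variable {A}

/-- The block diagonal sum `diag(p, q)`. -/
def MatrixProjection.diag (p q : MatrixProjection A) : MatrixProjection A where
  size := p.size + q.size
  size_pos := Nat.add_pos_left p.size_pos _
  mat := (Matrix.fromBlocks p.mat 0 0 q.mat).submatrix finSumFinEquiv.symm finSumFinEquiv.symm
  isStarProjection := isStarProjection_submatrix
    (isStarProjection_fromBlocks p.isStarProjection q.isStarProjection) _

theorem MatrixProjection.mvN_diag (p q : MatrixProjection A) :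
    MvN (Matrix.fromBlocks p.mat 0 0 q.mat) (p.diag q).mat :=
  MvN.submatrix (isStarProjection_fromBlocks p.isStarProjection q.isStarProjection) _

variable (A)

/-- Murray–von Neumann equivalence on `𝒫_∞(A)`. -/
instance mvNSetoid : Setoid (MatrixProjection A) where
  r p q := MvN p.mat q.mat
  iseqv :=
    { refl := fun p => MvN.refl p.isStarProjection
      symm := MvN.symm
      trans := fun {p _ r} h h' => MvN.trans p.isStarProjection r.isStarProjection h h' }

/-- The Murray–von Neumann semigroup `𝒟(A)` of `A`. -/
def MvNSemigroup : Type _ := Quotient (mvNSetoid A)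

variable {A}

/-- The class of a projection in `𝒟(A)`. -/
def MvNSemigroup.mk (p : MatrixProjection A) : MvNSemigroup A := Quotient.mk (mvNSetoid A) p

theorem MvNSemigroup.mk_eq_mk {p q : MatrixProjection A} :
    MvNSemigroup.mk p = MvNSemigroup.mk q ↔ MvN p.mat q.mat := Quotient.eq

theorem mvN_diag_congr {p p' q q' : MatrixProjection A} (h : MvN p.mat p'.mat)
    (h' : MvN q.mat q'.mat) : MvN (p.diag q).mat (p'.diag q').mat := by
  have hb := isStarProjection_fromBlocks p.isStarProjection q.isStarProjection
  refine MvN.trans (p.diag q).isStarProjection (p'.diag q').isStarProjection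
    (p.mvN_diag q).symm ?_
  exact MvN.trans hb (p'.diag q').isStarProjection (MvN.fromBlocks h h') (p'.mvN_diag q')

/-- `[p] + [q] = [diag(p, q)]`. -/
instance : Add (MvNSemigroup A) where
  add := Quotient.map₂ MatrixProjection.diag fun _ _ h _ _ h' => mvN_diag_congr h h'

theorem MvNSemigroup.mk_add_mk (p q : MatrixProjection A) :
    MvNSemigroup.mk p + MvNSemigroup.mk q = MvNSemigroup.mk (p.diag q) := rfl

/-- The neutral element of `𝒟(A)` is the class of `0 ∈ M_1(A)`. -/
instance : Zero (MvNSemigroup A) where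
  zero := MvNSemigroup.mk ⟨1, one_pos, 0, .zero _⟩

theorem MvNSemigroup.zero_def :
    (0 : MvNSemigroup A) = MvNSemigroup.mk ⟨1, one_pos, 0, .zero _⟩ := rfl

theorem MvNSemigroup.add_comm' (a b : MvNSemigroup A) : a + b = b + a := by
  induction a using Quotient.inductionOn with | _ p
  induction b using Quotient.inductionOn with | _ q
  refine MvNSemigroup.mk_eq_mk.mpr ?_
  have hpq := isStarProjection_fromBlocks p.isStarProjection q.isStarProjection
  refine MvN.trans (p.diag q).isStarProjection (q.diag p).isStarProjection
    (p.mvN_diag q).symm ?_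
  refine MvN.trans hpq (q.diag p).isStarProjection ?_ (q.mvN_diag p)
  convert MvN.submatrix hpq (Equiv.sumComm (Fin q.size) (Fin p.size)) using 1
  exact (Matrix.fromBlocks_submatrix_sum_swap_sum_swap _ _ _ _).symm

theorem MvNSemigroup.add_assoc' (a b c : MvNSemigroup A) : a + b + c = a + (b + c) := by
  induction a using Quotient.inductionOn with | _ p
  induction b using Quotient.inductionOn with | _ q
  induction c using Quotient.inductionOn with | _ r
  refine MvNSemigroup.mk_eq_mk.mpr ?_
  have hp := p.isStarProjection
  have hq := q.isStarProjection
  have hr := r.isStarProjection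
  have h1 := isStarProjection_fromBlocks (isStarProjection_fromBlocks hp hq) hr
  have h2 := isStarProjection_fromBlocks hp (isStarProjection_fromBlocks hq hr)
  have e1 : MvN ((p.diag q).diag r).mat
      (Matrix.fromBlocks (Matrix.fromBlocks p.mat 0 0 q.mat) 0 0 r.mat) :=
    MvN.trans ((p.diag q).diag r).isStarProjection h1 ((p.diag q).mvN_diag r).symm
      (MvN.fromBlocks (p.mvN_diag q).symm (MvN.refl hr))
  have e2 : MvN (Matrix.fromBlocks p.mat 0 0 (Matrix.fromBlocks q.mat 0 0 r.mat))
      (p.diag (q.diag r)).mat :=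
    MvN.trans h2 (p.diag (q.diag r)).isStarProjection
      (MvN.fromBlocks (MvN.refl hp) (q.mvN_diag r)) (p.mvN_diag (q.diag r))
  refine MvN.trans ((p.diag q).diag r).isStarProjection (p.diag (q.diag r)).isStarProjection e1 ?_
  refine MvN.trans h1 (p.diag (q.diag r)).isStarProjection ?_ e2
  convert MvN.submatrix h1 (Equiv.sumAssoc (Fin p.size) (Fin q.size) (Fin r.size)).symm using 1
  ext i j
  rcases i with i | i | i <;> rcases j with j | j | j <;> rfl

theorem MvNSemigroup.zero_add' (a : MvNSemigroup A) : 0 + a = a := by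
  induction a using Quotient.inductionOn with | _ p
  refine MvNSemigroup.mk_eq_mk.mpr ?_
  have hp := p.isStarProjection
  have h1 : p.mat * p.mat = p.mat := hp.isIdempotentElem
  have h2 : p.matᴴ = p.mat := hp.isSelfAdjoint
  refine MvN.trans (MatrixProjection.isStarProjection _) hp
    (MatrixProjection.mvN_diag _ p).symm ?_
  refine ⟨Matrix.fromCols 0 p.mat, ?_, ?_⟩
  · rw [Matrix.conjTranspose_fromCols_eq_fromRows_conjTranspose, Matrix.fromRows_mul_fromCols]
    simp [h1, h2]
  · rw [Matrix.conjTranspose_fromCols_eq_fromRows_conjTranspose, Matrix.fromCols_mul_fromRows]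
    simp [h1, h2]

instance : AddCommMonoid (MvNSemigroup A) where
  add_assoc := MvNSemigroup.add_assoc'
  zero_add := MvNSemigroup.zero_add'
  add_zero a := by rw [MvNSemigroup.add_comm', MvNSemigroup.zero_add']
  add_comm := MvNSemigroup.add_comm'
  nsmul := nsmulRec

variable (A)

/-- `K₀(A)`: the Grothendieck group of the Murray–von Neumann semigroup of `A`. -/
abbrev KZero : Type _ := Algebra.GrothendieckAddGroup (MvNSemigroup A)

end KZero

/-- The additive group of the functions in `S` that take only integer values. -/
def integerValued (S : StarSubalgebra ℂ LInfty) : AddSubgroup S where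
  carrier := {f | ∀ n : ℕ, ∃ k : ℤ, (f : LInfty) n = (k : ℂ)}
  zero_mem' n := ⟨0, by simp⟩
  add_mem' {f g} hf hg n := by
    obtain ⟨a, ha⟩ := hf n
    obtain ⟨b, hb⟩ := hg n
    exact ⟨a + b, by push_cast; rw [← ha, ← hb]; rfl⟩
  neg_mem' {f} hf n := by
    obtain ⟨a, ha⟩ := hf n
    exact ⟨-a, by push_cast; rw [← ha]; rfl⟩

end Arith

end

noncomputable section

open Filter Topology

namespace Arith

/-! ### Sequences of zero entropy, combinatorially -/

/-! Zero anqie entropy is equivalent to a condition on words: for every `ε`, the number of words of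
length `m` up to `ε` grows subexponentially (`anqieEntropy_eq_zero_iff`). This holds because the
point evaluations are dense in the maximal ideal space and the numbers `ρ (σ^j f)` embed that space
in `ℂ^ℕ`. The word condition is stable under pairing, continuous operations and uniform limits, so
it defines a C*-algebra.

For `K₀`, the pointwise rank of a projection is its trace. It gives a homomorphism from the
Murray–von Neumann semigroup to the integer-valued functions. If it is injective and its differences
exhaust the target, the Grothendieck group is the target. Differences suffice by splitting a
function into positive and negative parts and realising a bounded natural-valued function as the
trace of a diagonal of indicators.

Injectivity is the hard point. Equal ranks give partial isometries `w n` between `p(n)` and `q(n)`,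
but an arbitrary choice of them may have positive entropy. By `ZeroEntropy.exists_zeroEntropy_nat`
the pair `(p, q)` is uniformly close to its values along some `g : ℕ → ℕ` of zero entropy for the
discrete metric. Then `w ∘ g` has zero entropy and almost intertwines `p(n)` and `q(n)`; the polar
part of `q(n) w(g n) p(n)` does so exactly and depends continuously on the data.

Rounding values one by one need not keep entropy zero, so `g` rounds whole blocks, at lengths `m 0 ∣
m 1 ∣ ⋯` and with summable errors. Rounding longer blocks moves the shorter blocks inside them as
units, so every scale keeps its bound on the number of blocks. -/

/-- The colouring `c` of `ℕ` separates the words of length `m` of `F` up to `ε`: words of `F` that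
start at positions of the same colour are `ε`-close. -/
def IsWordColoring {Y α : Type*} [PseudoMetricSpace Y] (F : ℕ → Y) (ε : ℝ) (m : ℕ) (c : ℕ → α) :
    Prop :=
  ∀ n n', c n = c n' → ∀ i < m, dist (F (n + i)) (F (n' + i)) < ε

/-- A sequence has zero entropy if for every `ε` the number of its words of length `m` up to `ε`
grows subexponentially. -/
def ZeroEntropy {Y : Type*} [PseudoMetricSpace Y] (F : ℕ → Y) : Prop :=
  ∀ ε > 0, ∀ η > 0, ∀ᶠ m : ℕ in atTop, ∃ C : ℕ, (C : ℝ) ≤ Real.exp (η * m) ∧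
    ∃ c : ℕ → Fin C, IsWordColoring F ε m c

section ZeroEntropy

variable {Y Z : Type*} [PseudoMetricSpace Y] [PseudoMetricSpace Z] {F : ℕ → Y} {G : ℕ → Z}

theorem IsWordColoring.exists_fin {ε : ℝ} {m : ℕ} {α : Type*} [Fintype α] {c : ℕ → α} {b : ℝ}
    (hc : IsWordColoring F ε m c) (hb : (Fintype.card α : ℝ) ≤ b) :
    ∃ C : ℕ, (C : ℝ) ≤ b ∧ ∃ c : ℕ → Fin C, IsWordColoring F ε m c :=
  ⟨_, hb, fun n => Fintype.equivFin α (c n), fun n n' h =>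
    hc n n' ((Fintype.equivFin α).injective h)⟩

/-- It suffices to colour the words of a single length. -/
theorem zeroEntropy_of_exists
    (h : ∀ ε > 0, ∀ η > 0, ∃ m : ℕ, 0 < m ∧ ∃ C : ℕ, (C : ℝ) ≤ Real.exp (η * m) ∧
      ∃ c : ℕ → Fin C, IsWordColoring F ε m c) : ZeroEntropy F := by
  intro ε hε η hη
  obtain ⟨m₀, hm₀, C, hC, c, hc⟩ := h ε hε (η / 2) (half_pos hη)
  filter_upwards [eventually_ge_atTop m₀] with m hm
  -- A word of length `m` is covered by `m / m₀ + 1` consecutive words of length `m₀`. Their total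
  -- length is at most `2 * m` once `m₀ ≤ m`, which is why the rate `η / 2` was requested.
  have hcol : IsWordColoring F ε m
      (fun n => fun j : Fin (m / m₀ + 1) => c (n + j * m₀)) := by
    intro n n' hnn i hi
    have hj : i / m₀ < m / m₀ + 1 := Nat.lt_succ_of_le (Nat.div_le_div_right hi.le)
    have := hc _ _ (congrFun hnn ⟨i / m₀, hj⟩) (i % m₀) (Nat.mod_lt _ hm₀)
    have hi' : i / m₀ * m₀ + i % m₀ = i := Nat.div_add_mod' i m₀
    simpa only [add_assoc, hi'] using this
  refine hcol.exists_fin ?_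
  have hle : (m₀ : ℝ) * ((m / m₀ + 1 : ℕ) : ℝ) ≤ 2 * m := by
    have : m₀ * (m / m₀ + 1) ≤ 2 * m := by
      have := Nat.mul_div_le m m₀
      rw [mul_add]
      omega
    exact_mod_cast this
  calc ((Fintype.card (Fin (m / m₀ + 1) → Fin C) : ℕ) : ℝ) = (C : ℝ) ^ (m / m₀ + 1) := by simp
    _ ≤ Real.exp (η / 2 * m₀) ^ (m / m₀ + 1) := pow_le_pow_left₀ (Nat.cast_nonneg _) hC _
    _ = Real.exp (η / 2 * (m₀ * ((m / m₀ + 1 : ℕ) : ℝ))) := by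
        rw [← Real.exp_nat_mul]; congr 1; ring
    _ ≤ Real.exp (η * m) := by
        apply Real.exp_le_exp.mpr
        nlinarith

theorem ZeroEntropy.of_forall_exists (hF : ZeroEntropy F)
    (h : ∀ ε > 0, ∃ δ > 0, ∀ n n', dist (F n) (F n') < δ → dist (G n) (G n') < ε) :
    ZeroEntropy G := by
  intro ε hε η hη
  obtain ⟨δ, hδ, hd⟩ := h ε hε
  filter_upwards [hF δ hδ η hη] with m ⟨C, hC, c, hc⟩
  exact ⟨C, hC, c, fun n n' hn i hi => hd _ _ (hc n n' hn i hi)⟩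

theorem zeroEntropy_of_forall_exists_dist_lt
    (h : ∀ ε > 0, ∃ G : ℕ → Y, ZeroEntropy G ∧ ∀ n, dist (F n) (G n) < ε) :
    ZeroEntropy F := by
  intro ε hε η hη
  obtain ⟨G, hG, hd⟩ := h (ε / 3) (by positivity)
  filter_upwards [hG (ε / 3) (by positivity) η hη] with m ⟨C, hC, c, hc⟩
  refine ⟨C, hC, c, fun n n' hn i hi => ?_⟩
  have h1 := hc n n' hn i hi
  have h2 := hd (n + i)
  have h3 := hd (n' + i)
  rw [dist_comm] at h3
  linarith [dist_triangle4 (F (n + i)) (G (n + i)) (G (n' + i)) (F (n' + i))]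

theorem zeroEntropy_const (y : Y) : ZeroEntropy fun _ => y := by
  intro ε hε η hη
  refine Eventually.of_forall fun m => ⟨1, ?_, fun _ => 0, fun n n' _ i _ => by simpa using hε⟩
  simpa using by positivity

theorem ZeroEntropy.pi {ι : Type*} [Fintype ι] {Y : ι → Type*} [∀ i, PseudoMetricSpace (Y i)]
    {F : ∀ i, ℕ → Y i} (hF : ∀ i, ZeroEntropy (F i)) : ZeroEntropy fun n i => F i n := by
  intro ε hε η hη
  -- The `+ 1` keeps the denominator nonzero when `ι` is empty.
  have hη' : 0 < η / (Fintype.card ι + 1) := by positivity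
  filter_upwards [eventually_all.mpr fun i => hF i ε hε _ hη'] with m hm
  choose C hC c hc using hm
  have hcol : IsWordColoring (fun n i => F i n) ε m fun n i => c i n := by
    intro n n' hn j hj
    exact (dist_pi_lt_iff hε).mpr fun i => hc i n n' (congrFun hn i) j hj
  classical
  refine hcol.exists_fin ?_
  calc ((Fintype.card (∀ i, Fin (C i)) : ℕ) : ℝ) = ∏ i, (C i : ℝ) := by
        simp [Fintype.card_pi]
    _ ≤ ∏ i : ι, Real.exp (η / (Fintype.card ι + 1) * m) :=
        Finset.prod_le_prod (fun i _ => Nat.cast_nonneg _) fun i _ => hC i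
    _ = Real.exp (Fintype.card ι * (η / (Fintype.card ι + 1) * m)) := by
        rw [Finset.prod_const, ← Real.exp_nat_mul, Finset.card_univ]
    _ ≤ Real.exp (η * m) := by
        apply Real.exp_le_exp.mpr
        have : (Fintype.card ι : ℝ) * (η / (Fintype.card ι + 1) * m)
            = (Fintype.card ι / (Fintype.card ι + 1)) * (η * m) := by ring
        rw [this]
        exact mul_le_of_le_one_left (by positivity)
          ((div_le_one (by positivity)).mpr (by linarith))

theorem ZeroEntropy.prodMk (hF : ZeroEntropy F) (hG : ZeroEntropy G) :
    ZeroEntropy fun n => (F n, G n) := by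
  intro ε hε η hη
  filter_upwards [hF ε hε (η / 2) (half_pos hη), hG ε hε (η / 2) (half_pos hη)] with m
    ⟨C, hC, c, hc⟩ ⟨D, hD, d, hd⟩
  have hcol : IsWordColoring (fun n => (F n, G n)) ε m fun n => (c n, d n) := by
    intro n n' hn j hj
    rw [Prod.ext_iff] at hn
    exact max_lt (hc n n' hn.1 j hj) (hd n n' hn.2 j hj)
  refine hcol.exists_fin ?_
  calc ((Fintype.card (Fin C × Fin D) : ℕ) : ℝ) = (C : ℝ) * D := by simp
    _ ≤ Real.exp (η / 2 * m) * Real.exp (η / 2 * m) :=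
        mul_le_mul hC hD (Nat.cast_nonneg _) (Real.exp_pos _).le
    _ = Real.exp (η * m) := by rw [← Real.exp_add]; congr 1; ring

/-- A colouring at precision `1` has finitely many colours, so every value is within `1` of one of
finitely many representative values. -/
theorem ZeroEntropy.isBounded_range (hF : ZeroEntropy F) : Bornology.IsBounded (Set.range F) := by
  obtain ⟨m, ⟨C, -, c, hc⟩, hm⟩ :=
    ((hF 1 one_pos 1 one_pos).and (eventually_gt_atTop 0)).exists
  classical
  let r : Fin C → ℕ := fun j => if h : ∃ n, c n = j then h.choose else 0
  have hr : ∀ n, c (r (c n)) = c n := by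
    intro n
    have h : ∃ n', c n' = c n := ⟨n, rfl⟩
    simp only [r, dif_pos h]
    exact h.choose_spec
  have hfin : (Set.range fun j => F (r j)).Finite := Set.finite_range _
  refine (hfin.isBounded.thickening (δ := 1)).subset ?_
  rintro _ ⟨n, rfl⟩
  exact Metric.mem_thickening_iff.mpr
    ⟨_, ⟨c n, rfl⟩, by simpa using hc n (r (c n)) (hr n).symm 0 hm⟩

theorem ZeroEntropy.comp_continuousOn (hF : ZeroEntropy F) {K : Set Y} (hK : IsCompact K)
    (hFK : ∀ n, F n ∈ K) {Φ : Y → Z} (hΦ : ContinuousOn Φ K) : ZeroEntropy fun n => Φ (F n) := by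
  refine hF.of_forall_exists fun ε hε => ?_
  obtain ⟨δ, hδ, h⟩ := Metric.uniformContinuousOn_iff.mp
    (hK.uniformContinuousOn_of_continuous hΦ) ε hε
  exact ⟨δ, hδ, fun n n' => h _ (hFK n) _ (hFK n')⟩

/-- The range is bounded, so its closure is compact and `Φ` is uniformly continuous there. -/
theorem ZeroEntropy.comp_continuous [ProperSpace Y] (hF : ZeroEntropy F) {Φ : Y → Z}
    (hΦ : Continuous Φ) : ZeroEntropy fun n => Φ (F n) :=
  hF.comp_continuousOn hF.isBounded_range.isCompact_closure
    (fun n => subset_closure ⟨n, rfl⟩) hΦ.continuousOn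

/-- A function of a sequence of zero entropy with values in a discrete space. -/
theorem ZeroEntropy.comp_nat {g : ℕ → ℕ} (hg : ZeroEntropy g) (Φ : ℕ → Z) :
    ZeroEntropy fun n => Φ (g n) :=
  hg.comp_continuous continuous_of_discreteTopology

end ZeroEntropy

/-! ### Approximation by sequences of zero entropy with finitely many values -/

section BlockMap

/-- The self-map of `ℕ` that translates the block `[b m, (b + 1) m)` to the block number `ρ b`. -/
def blockMap (m : ℕ) (ρ : ℕ → ℕ) (n : ℕ) : ℕ := ρ (n / m) * m + n % m

theorem blockMap_mul_add {m i : ℕ} (ρ : ℕ → ℕ) (b : ℕ) (hi : i < m) :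
    blockMap m ρ (b * m + i) = ρ b * m + i := by
  have hm : 0 < m := by omega
  rw [blockMap, mul_comm b, Nat.mul_add_div hm, Nat.mul_add_mod, Nat.div_eq_of_lt hi,
    Nat.mod_eq_of_lt hi, add_zero]

theorem blockMap_of_lt {m n : ℕ} {ρ : ℕ → ℕ} (hρ : ρ 0 = 0) (hn : n < m) :
    blockMap m ρ n = n := by
  simpa [hρ] using blockMap_mul_add ρ 0 hn

/-- Since `m ∣ M`, an aligned block of length `m` lies inside one aligned block of length `M`, and
is translated with it by a multiple of `m`. -/
theorem exists_blockMap_mul_add {m M : ℕ} (hM : m ∣ M) (hM0 : 0 < M) (ρ : ℕ → ℕ) (b : ℕ) :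
    ∃ b', ∀ i < m, blockMap M ρ (b * m + i) = b' * m + i := by
  obtain ⟨t, rfl⟩ := hM
  have ht : 0 < t := Nat.pos_of_mul_pos_left hM0
  refine ⟨ρ (b / t) * t + b % t, fun i hi => ?_⟩
  have hlt : b % t * m + i < m * t := by
    have h1 : b % t + 1 ≤ t := Nat.mod_lt _ ht
    nlinarith
  have hb : b * m + i = b / t * (m * t) + (b % t * m + i) := by
    conv_lhs => rw [← Nat.div_add_mod' b t]
    ring
  rw [hb, blockMap_mul_add ρ _ hlt]
  ring

/-- The composition of the first `k + 1` block maps. -/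
def iterBlockMap (m : ℕ → ℕ) (ρ : ℕ → ℕ → ℕ) : ℕ → ℕ → ℕ
  | 0 => blockMap (m 0) (ρ 0)
  | k + 1 => fun n => iterBlockMap m ρ k (blockMap (m (k + 1)) (ρ (k + 1)) n)

theorem iterBlockMap_succ (m : ℕ → ℕ) (ρ : ℕ → ℕ → ℕ) (k n : ℕ) : iterBlockMap m ρ (k + 1) n =
    iterBlockMap m ρ k (blockMap (m (k + 1)) (ρ (k + 1)) n) := rfl

variable {m : ℕ → ℕ} {ρ : ℕ → ℕ → ℕ}

/-- The block map of index `k` fixes everything below `m k`, so the compositions stabilise at each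
point and the diagonal is their limit. -/
theorem iterBlockMap_eq_self (hρ : ∀ k, ρ k 0 = 0) (hm : ∀ k, k < m k) {k n : ℕ} (h : n ≤ k) :
    iterBlockMap m ρ k n = iterBlockMap m ρ n n := by
  induction k, h using Nat.le_induction with
  | base => rfl
  | succ k hk ih =>
    rw [iterBlockMap_succ, blockMap_of_lt (hρ _) (by have := hm (k + 1); omega), ih]

/-- The maps of index above `j` act first, and each carries aligned blocks of length `m j` to
aligned blocks of the same length. -/
theorem exists_iterBlockMap_mul_add (hm : ∀ k, k < m k) (hd : ∀ k, m k ∣ m (k + 1)) {j k : ℕ}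
    (h : j ≤ k) (b : ℕ) :
    ∃ a, ∀ i < m j, iterBlockMap m ρ k (b * m j + i) = iterBlockMap m ρ j (a * m j + i) := by
  induction k, h using Nat.le_induction generalizing b with
  | base => exact ⟨b, fun i _ => rfl⟩
  | succ k hk ih =>
    have hdvd : m j ∣ m (k + 1) :=
      Nat.le_induction (P := fun i _ => m j ∣ m i) dvd_rfl (fun i _ hi => hi.trans (hd i)) (k + 1)
        (Nat.le_succ_of_le hk)
    obtain ⟨b', hb'⟩ := exists_blockMap_mul_add hdvd ((Nat.zero_le _).trans_lt (hm (k + 1)))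
      (ρ (k + 1)) b
    obtain ⟨a, ha⟩ := ih b'
    exact ⟨a, fun i hi => by rw [iterBlockMap_succ, hb' i hi, ha i hi]⟩

theorem iterBlockMap_mul_add_congr {j a a' i : ℕ} (h : ρ j a = ρ j a') (hi : i < m j) :
    iterBlockMap m ρ j (a * m j + i) = iterBlockMap m ρ j (a' * m j + i) := by
  cases j with
  | zero => rw [iterBlockMap, blockMap_mul_add _ _ hi, blockMap_mul_add _ _ hi, h]
  | succ j => rw [iterBlockMap_succ, iterBlockMap_succ, blockMap_mul_add _ _ hi,
    blockMap_mul_add _ _ hi, h]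

/-- The limit of the compositions of block maps has the block structure of each of them. -/
theorem isWordColoring_iterBlockMap (hρ : ∀ k, ρ k 0 = 0) (hm : ∀ k, k < m k)
    (hd : ∀ k, m k ∣ m (k + 1)) (j : ℕ) {α : Type*} {c : ℕ → α}
    (hc : ∀ a a', c a = c a' → ρ j a = ρ j a') {ε : ℝ} (hε : 0 < ε) :
    ∃ d : ℕ → Fin (m j) × α × α,
      IsWordColoring (fun n => iterBlockMap m ρ n n) ε (m j) d := by
  have hm0 : 0 < m j := (Nat.zero_le _).trans_lt (hm j)
  -- On the whole block the diagonal agrees with one composition, of index at least `j` and beyond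
  -- the end of the block.
  have key : ∀ b, ∃ a, ∀ i < m j,
      iterBlockMap m ρ (b * m j + i) (b * m j + i) = iterBlockMap m ρ j (a * m j + i) := by
    intro b
    obtain ⟨a, ha⟩ := exists_iterBlockMap_mul_add (ρ := ρ) hm hd
      (le_max_left j (b * m j + m j)) b
    exact ⟨a, fun i hi => (iterBlockMap_eq_self hρ hm
      ((Nat.add_le_add_left hi.le _).trans (le_max_right _ _))).symm.trans (ha i hi)⟩
  choose a ha using key
  -- A word of length `m j` meets at most two consecutive aligned blocks, so it is determined by its
  -- offset and the colours of the two source blocks.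
  refine ⟨fun n => (⟨n % m j, Nat.mod_lt _ hm0⟩, c (a (n / m j)), c (a (n / m j + 1))), ?_⟩
  intro n n' hn i hi
  simp only [Prod.mk.injEq, Fin.mk.injEq] at hn
  obtain ⟨h1, h2, h3⟩ := hn
  have hb := Nat.div_add_mod' n (m j)
  have hb' := Nat.div_add_mod' n' (m j)
  have hlt := Nat.mod_lt n hm0
  suffices iterBlockMap m ρ (n + i) (n + i) = iterBlockMap m ρ (n' + i) (n' + i) by
    simpa [this] using hε
  rcases lt_or_ge (n % m j + i) (m j) with hlt' | hge
  · have e : n + i = n / m j * m j + (n % m j + i) := by omega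
    have e' : n' + i = n' / m j * m j + (n % m j + i) := by omega
    rw [e, e', ha _ _ hlt', ha _ _ hlt', iterBlockMap_mul_add_congr (hc _ _ h2) hlt']
  · have e : n + i = (n / m j + 1) * m j + (n % m j + i - m j) := by
      rw [add_mul]; omega
    have e' : n' + i = (n' / m j + 1) * m j + (n % m j + i - m j) := by
      rw [add_mul]; omega
    have hlt'' : n % m j + i - m j < m j := by omega
    rw [e, e', ha _ _ hlt'', ha _ _ hlt'', iterBlockMap_mul_add_congr (hc _ _ h3) hlt'']

/-- The errors form a geometric series; the bound is its partial sum. -/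
theorem dist_iterBlockMap_lt {Y : Type*} [PseudoMetricSpace Y] {F : ℕ → Y} {ε : ℝ}
    (h : ∀ k n, dist (F n) (F (blockMap (m k) (ρ k) n)) < ε / 2 ^ (k + 1)) (k n : ℕ) :
    dist (F n) (F (iterBlockMap m ρ k n)) < ε - ε / 2 ^ (k + 1) := by
  induction k generalizing n with
  | zero => have := h 0 n; rw [iterBlockMap]; norm_num at this ⊢; linarith
  | succ k ih =>
    refine (dist_triangle _ _ _).trans_lt ((add_lt_add (h (k + 1) n) (ih _)).trans_eq ?_)
    rw [pow_succ 2 (k + 1)]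
    field_simp
    ring

end BlockMap

/-- Block lengths and colourings for all precisions at once. -/
theorem ZeroEntropy.exists_seq_isWordColoring {Y : Type*} [PseudoMetricSpace Y] {F : ℕ → Y}
    (hF : ZeroEntropy F) {ε : ℝ} (hε : 0 < ε) :
    ∃ m : ℕ → ℕ, (∀ k, k < m k) ∧ (∀ k, m k ∣ m (k + 1)) ∧
      ∀ k, (m k : ℝ) ≤ Real.exp (1 / (k + 1) * m k) ∧
        ∃ C : ℕ, (C : ℝ) ≤ Real.exp (1 / (k + 1) * m k) ∧
          ∃ c : ℕ → Fin C, IsWordColoring F (ε / 2 ^ (k + 1)) (m k) c := by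
  let P : ℕ → ℕ → Prop := fun k m => k < m ∧ (m : ℝ) ≤ Real.exp (1 / (k + 1) * m) ∧
        ∃ C : ℕ, (C : ℝ) ≤ Real.exp (1 / (k + 1) * m) ∧
          ∃ c : ℕ → Fin C, IsWordColoring F (ε / 2 ^ (k + 1)) m c
  have hP : ∀ k, ∀ᶠ m in atTop, P k m := by
    intro k
    have hk : (0 : ℝ) < 1 / (k + 1) := by positivity
    -- This will pay for the `m` possible offsets of a word relative to the blocks.
    have hexp : ∀ᶠ m : ℕ in atTop, (m : ℝ) ≤ Real.exp (1 / (k + 1) * m) := by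
      have h := (isLittleO_pow_exp_pos_mul_atTop 1 hk).comp_tendsto tendsto_natCast_atTop_atTop
      filter_upwards [h.bound one_pos] with m hm
      simpa using hm
    exact (eventually_gt_atTop k).and (hexp.and (hF _ (by positivity) _ hk))
  have hs : ∀ k M, ∃ m, 0 < M → M ∣ m ∧ P k m := by
    intro k M
    obtain ⟨N, hN⟩ := eventually_atTop.mp (hP k)
    exact ⟨M * N, fun hM => ⟨dvd_mul_right _ _, hN _ (Nat.le_mul_of_pos_left N hM)⟩⟩
  choose s hs using hs
  let m : ℕ → ℕ := fun k => Nat.rec (s 0 1) (fun k mk => s (k + 1) mk) k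
  have hPm : ∀ k, P k (m k) := by
    intro k
    induction k with
    | zero => exact (hs 0 1 one_pos).2
    | succ k ih => exact (hs (k + 1) (m k) ((Nat.zero_le _).trans_lt ih.1)).2
  exact ⟨m, fun k => (hPm k).1,
    fun k => (hs (k + 1) (m k) ((Nat.zero_le _).trans_lt (hPm k).1)).1, fun k => (hPm k).2⟩

/-- A sequence of zero entropy is uniformly approximated by its values at a sequence of positions
that is of zero entropy for the discrete metric, and in particular takes finitely many values. -/
theorem ZeroEntropy.exists_zeroEntropy_nat {Y : Type*} [PseudoMetricSpace Y] {F : ℕ → Y}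
    (hF : ZeroEntropy F) {ε : ℝ} (hε : 0 < ε) :
    ∃ g : ℕ → ℕ, ZeroEntropy g ∧ ∀ n, dist (F n) (F (g n)) < ε := by
  obtain ⟨m, hm, hd, h⟩ := hF.exists_seq_isWordColoring hε
  choose hmexp C hC c hc using h
  -- Taking the least block of each colour makes block `0` its own representative, as stabilisation
  -- requires.
  let r : ∀ k, Fin (C k) → ℕ := fun k x => sInf {b | c k (b * m k) = x}
  let ρ : ℕ → ℕ → ℕ := fun k b => r k (c k (b * m k))
  have hr : ∀ k b, c k (ρ k b * m k) = c k (b * m k) := fun k b =>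
    Nat.sInf_mem (s := {b' | c k (b' * m k) = c k (b * m k)}) ⟨b, rfl⟩
  have hρ : ∀ k, ρ k 0 = 0 := fun k => Nat.sInf_eq_zero.mpr (Or.inl rfl)
  have hm0 : ∀ k, 0 < m k := fun k => (Nat.zero_le _).trans_lt (hm k)
  have hφ : ∀ k n, dist (F n) (F (blockMap (m k) (ρ k) n)) < ε / 2 ^ (k + 1) := by
    intro k n
    have := hc k _ _ (hr k (n / m k)).symm (n % m k) (Nat.mod_lt _ (hm0 k))
    rwa [Nat.div_add_mod'] at this
  refine ⟨fun n => iterBlockMap m ρ n n, zeroEntropy_of_exists ?_, fun n => ?_⟩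
  · intro δ hδ η hη
    -- Three factors `exp (m j / (j + 1))` occur: one for the offset and two for the colours.
    obtain ⟨j, hj⟩ := exists_nat_gt (3 / η)
    obtain ⟨d, hd'⟩ := isWordColoring_iterBlockMap hρ hm hd j
      (c := fun a => c j (a * m j)) (fun a a' h => congrArg (r j) h) hδ
    refine ⟨m j, hm0 j, hd'.exists_fin ?_⟩
    calc ((Fintype.card (Fin (m j) × Fin (C j) × Fin (C j)) : ℕ) : ℝ)
        = (m j : ℝ) * (C j * C j) := by simp
      _ ≤ Real.exp (1 / (j + 1) * m j) *
          (Real.exp (1 / (j + 1) * m j) * Real.exp (1 / (j + 1) * m j)) := by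
          have := hmexp j
          have := hC j
          gcongr
      _ = Real.exp (3 / (j + 1) * m j) := by
          rw [← Real.exp_add, ← Real.exp_add]; congr 1; ring
      _ ≤ Real.exp (η * m j) := by
          apply Real.exp_le_exp.mpr
          gcongr
          rw [div_le_iff₀ (by positivity)]
          rw [div_lt_iff₀ hη] at hj
          nlinarith
  · exact (dist_iterBlockMap_lt hφ n n).trans_le (sub_le_self _ (by positivity))

/-! ### Anqie entropy zero is combinatorial entropy zero -/

section Covers

variable {X : Type*}

theorem sUnion_iteratedCover (T : X → X) {𝒰 : Set (Set X)} (h𝒰 : ⋃₀ 𝒰 = Set.univ) (n : ℕ) :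
    ⋃₀ iteratedCover T 𝒰 n = Set.univ := by
  refine Set.eq_univ_of_forall fun x => ?_
  have h : ∀ y, ∃ U ∈ 𝒰, y ∈ U := fun y => Set.mem_sUnion.mp (h𝒰 ▸ Set.mem_univ y)
  choose U hU hmem using h
  exact ⟨⋂ i : Fin n, (T^[i]) ⁻¹' (U (T^[i] x)), ⟨fun i => U (T^[i] x), fun i => hU _, rfl⟩,
    Set.mem_iInter.mpr fun i => hmem _⟩

/-- The cover number of an iterated open cover is attained. -/
theorem exists_card_eq_coverNumber [TopologicalSpace X] [CompactSpace X] (T : C(X, X))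
    {𝒰 : Set (Set X)} (ho : ∀ U ∈ 𝒰, IsOpen U) (h𝒰 : ⋃₀ 𝒰 = Set.univ) (n : ℕ) :
    ∃ s : Finset (Set X), (s : Set (Set X)) ⊆ iteratedCover T 𝒰 n ∧
      ⋃₀ (s : Set (Set X)) = Set.univ ∧ s.card = coverNumber (iteratedCover T 𝒰 n) := by
  have hopen : ∀ V ∈ iteratedCover T 𝒰 n, IsOpen V := by
    rintro _ ⟨U, hU, rfl⟩
    exact isOpen_iInter_of_finite fun i => (ho _ (hU i)).preimage (T.continuous.iterate i)
  obtain ⟨t, ht, hfin, hcov⟩ := isCompact_univ.elim_finite_subcover_image (c := id) hopen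
    (by simpa [Set.sUnion_eq_biUnion] using (sUnion_iteratedCover T h𝒰 n).ge)
  -- Compactness is needed here because `sInf ∅ = 0` in `ℕ`.
  have hne : {k | ∃ s : Finset (Set X), (s : Set (Set X)) ⊆ iteratedCover T 𝒰 n ∧
      ⋃₀ (s : Set (Set X)) = Set.univ ∧ s.card = k}.Nonempty :=
    ⟨_, hfin.toFinset, by simpa using ht, by
      simpa [Set.sUnion_eq_biUnion] using Set.univ_subset_iff.mp hcov, rfl⟩
  exact Nat.sInf_mem hne

theorem coverEntropy_nonneg (T : X → X) (𝒰 : Set (Set X)) : 0 ≤ coverEntropy T 𝒰 := by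
  refine le_limsup_of_frequently_le (Frequently.of_forall fun n => ?_)
  exact_mod_cast div_nonneg (Real.log_natCast_nonneg _) (Nat.cast_nonneg n)

theorem topEntropy_nonneg [TopologicalSpace X] [CompactSpace X] (T : C(X, X)) :
    0 ≤ topEntropy T :=
  (coverEntropy_nonneg T {Set.univ}).trans
    (le_iSup₂ (f := fun 𝒰 (_ : 𝒰 ∈ {𝒰 : Set (Set X) | (∀ U ∈ 𝒰, IsOpen U) ∧
      ⋃₀ 𝒰 = Set.univ}) => coverEntropy T 𝒰) {Set.univ} (by simp))

theorem coverEntropy_le_of_eventually {T : X → X} {𝒰 : Set (Set X)}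
    (h : ∀ η > 0, ∀ᶠ n : ℕ in atTop, (coverNumber (iteratedCover T 𝒰 n) : ℝ) ≤ Real.exp (η * n)) :
    coverEntropy T 𝒰 ≤ 0 := by
  refine EReal.le_of_forall_lt_iff_le.mp fun η hη => ?_
  have hη' : 0 < η := by exact_mod_cast hη
  refine limsup_le_of_le (h := ?_)
  filter_upwards [h η hη', eventually_gt_atTop 0] with n hn hn0
  have hn0' : (0 : ℝ) < n := by exact_mod_cast hn0
  rw [EReal.coe_le_coe_iff, div_le_iff₀ hn0']
  rcases Nat.eq_zero_or_pos (coverNumber (iteratedCover T 𝒰 n)) with h0 | h0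
  · rw [h0]; simpa using by positivity
  · exact (Real.log_le_iff_le_exp (by exact_mod_cast h0)).mpr hn

theorem eventually_of_coverEntropy_le {T : X → X} {𝒰 : Set (Set X)}
    (h : coverEntropy T 𝒰 ≤ 0) {η : ℝ} (hη : 0 < η) :
    ∀ᶠ n : ℕ in atTop, (coverNumber (iteratedCover T 𝒰 n) : ℝ) ≤ Real.exp (η * n) := by
  have hlt : coverEntropy T 𝒰 < (η : EReal) := h.trans_lt (by exact_mod_cast hη)
  filter_upwards [eventually_lt_of_limsup_lt hlt, eventually_gt_atTop 0] with n hn hn0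
  have hn0' : (0 : ℝ) < n := by exact_mod_cast hn0
  rw [EReal.coe_lt_coe_iff, div_lt_iff₀ hn0'] at hn
  rcases Nat.eq_zero_or_pos (coverNumber (iteratedCover T 𝒰 n)) with h0 | h0
  · rw [h0]; simpa using by positivity
  · exact (Real.log_le_iff_le_exp (by exact_mod_cast h0)).mp hn.le

end Covers

/-! ### The maximal ideal space: density of point evaluations and orbit coordinates -/

namespace Anqie

variable (A : Anqie)

theorem addMap_apply (ρ : A.Spectrum) (a : A.alg) : A.addMap ρ a = ρ (A.shiftHom a) := rfl

theorem addMap_iterate_apply (ρ : A.Spectrum) (a : A.alg) (k : ℕ) :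
    (A.addMap^[k] ρ) a = ρ (A.shiftHom^[k] a) := by
  induction k generalizing ρ with
  | zero => rfl
  | succ k ih => rw [Function.iterate_succ_apply, ih, addMap_apply, Function.iterate_succ_apply']

theorem addMap_iterate_eval (n k : ℕ) : A.addMap^[k] (A.eval n) = A.eval (n + k) := by
  induction k with
  | zero => rfl
  | succ k ih => rw [Function.iterate_succ_apply', ih, addMap_eval, add_assoc]

theorem shiftHom_iterate_apply (a : A.alg) (k n : ℕ) :
    ((A.shiftHom^[k] a : A.alg) : LInfty) n = (a : LInfty) (n + k) := by
  induction k generalizing n with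
  | zero => rfl
  | succ k ih =>
    rw [Function.iterate_succ_apply']
    exact (ih (n + 1)).trans (by rw [add_assoc, add_comm 1])

theorem spectrum_map_star (ρ : A.Spectrum) (a : A.alg) : ρ (star a) = star (ρ a) :=
  have : IsClosed (A.alg : Set LInfty) := A.isClosed
  map_star ρ a

/-- The point evaluations are dense in the maximal ideal space, in terms of finitely many
elements of the algebra. -/
theorem exists_eval_near (ρ : A.Spectrum) {J : ℕ} (a : Fin J → A.alg) {ε : ℝ} (hε : 0 < ε) :
    ∃ n, ∀ j, dist (A.eval n (a j)) (ρ (a j)) < ε := by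
  by_contra! h
  have : IsClosed (A.alg : Set LInfty) := A.isClosed
  let b : Fin J → A.alg := fun j => a j - algebraMap ℂ A.alg (ρ (a j))
  -- `g` is at least `ε ^ 2` at every point of `ℕ`, hence invertible in `ℓ^∞(ℕ)`. By spectral
  -- permanence it is invertible in the closed subalgebra, which contradicts `ρ g = 0`.
  let g : A.alg := ∑ j, star (b j) * b j
  have hρb : ∀ j, ρ (b j) = 0 := fun j => by
    simp only [b, map_sub, AlgHomClass.commutes]; simp
  have hρg : ρ g = 0 := by simp [g, hρb]
  have hgn : ∀ n, (g : LInfty) n = ((∑ j, ‖A.eval n (a j) - ρ (a j)‖ ^ 2 : ℝ) : ℂ) := by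
    intro n
    have : (g : LInfty) n = A.eval n g := rfl
    rw [this]
    simp only [g, map_sum, map_mul, Complex.ofReal_sum]
    refine Finset.sum_congr rfl fun j _ => ?_
    have hs : A.eval n (star (b j)) = star (A.eval n (b j)) := rfl
    have hb : A.eval n (b j) = A.eval n (a j) - ρ (a j) := rfl
    rw [hs, hb, mul_comm]
    exact (Complex.mul_conj' _).trans (by push_cast; rfl)
  have hlow : ∀ n, ε ^ 2 ≤ ∑ j, ‖A.eval n (a j) - ρ (a j)‖ ^ 2 := by
    intro n
    obtain ⟨j, hj⟩ := h n
    rw [dist_eq_norm] at hj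
    exact (pow_le_pow_left₀ hε.le hj 2).trans (Finset.single_le_sum
      (f := fun j => ‖A.eval n (a j) - ρ (a j)‖ ^ 2) (fun i _ => by positivity)
      (Finset.mem_univ j))
  have hne : ∀ n, (g : LInfty) n ≠ 0 := fun n => by
    rw [hgn]
    exact_mod_cast ((pow_pos hε 2).trans_le (hlow n)).ne'
  let i : LInfty := BoundedContinuousFunction.ofNormedAddCommGroup (fun n => ((g : LInfty) n)⁻¹)
    continuous_of_discreteTopology ((ε ^ 2)⁻¹) fun n => by
      rw [hgn, norm_inv, Complex.norm_real]
      exact inv_anti₀ (by positivity) ((hlow n).trans (le_abs_self _))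
  have hunit : IsUnit (g : LInfty) := by
    refine IsUnit.of_mul_eq_one i ?_
    ext n
    exact mul_inv_cancel₀ (hne n)
  have := ((StarSubalgebra.coe_isUnit (S := A.alg)).mp hunit).map ρ
  rw [hρg] at this
  exact not_isUnit_zero this

end Anqie

/-- The element `f` of the anqie that it generates. -/
def anqieGenerator (f : LInfty) : (generatedAnqie {f}).alg :=
  ⟨f, subset_generatedAnqie {f} rfl⟩

/-- The orbit of a multiplicative state in terms of the generator. -/
def generatorOrbit (f : LInfty) (ρ : (generatedAnqie {f}).Spectrum) (j : ℕ) : ℂ :=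
  ρ ((generatedAnqie {f}).shiftHom^[j] (anqieGenerator f))

theorem continuous_generatorOrbit (f : LInfty) : Continuous (generatorOrbit f) :=
  continuous_pi fun j =>
    (WeakDual.eval_continuous ((generatedAnqie {f}).shiftHom^[j] (anqieGenerator f))).comp
      continuous_subtype_val

/-- The elements on which all iterates of the two states agree form an anqie containing `f`. Asking
for all iterates, not only the states themselves, is what makes this set shift-invariant. -/
theorem generatorOrbit_injective (f : LInfty) : Function.Injective (generatorOrbit f) := by
  intro ρ ρ' h
  let A : Anqie := generatedAnqie {f}
  let E : StarSubalgebra ℂ A.alg :=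
    { carrier := {a | ∀ k, (A.addMap^[k] ρ) a = (A.addMap^[k] ρ') a}
      mul_mem' := fun ha hb k => by rw [map_mul, map_mul, ha k, hb k]
      add_mem' := fun ha hb k => by rw [map_add, map_add, ha k, hb k]
      algebraMap_mem' := fun z k => by rw [AlgHomClass.commutes, AlgHomClass.commutes]
      star_mem' := fun ha k => by rw [A.spectrum_map_star, A.spectrum_map_star, ha k] }
  have hE : IsClosed (E : Set A.alg) := by
    have : (E : Set A.alg) = ⋂ k, {a | (A.addMap^[k] ρ) a = (A.addMap^[k] ρ') a} := by
      ext a; simp only [Set.mem_iInter]; rfl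
    rw [this]
    exact isClosed_iInter fun k => isClosed_eq (map_continuous _) (map_continuous _)
  let B : Anqie :=
    { alg := E.map A.alg.subtype
      isClosed := by
        rw [StarSubalgebra.coe_map]
        exact A.isClosed.isClosedEmbedding_subtypeVal.isClosedMap _ hE
      shift_mem := by
        rintro _ ⟨a, ha, rfl⟩
        exact ⟨A.shiftHom a, fun k => by
          have := ha (k + 1)
          rwa [Function.iterate_succ_apply', Function.iterate_succ_apply'] at this, rfl⟩ }
  have hB : {f} ⊆ (B.alg : Set LInfty) := by
    refine Set.singleton_subset_iff.mpr ⟨anqieGenerator f, fun k => ?_, rfl⟩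
    rw [A.addMap_iterate_apply, A.addMap_iterate_apply]
    exact congrFun h k
  ext a
  obtain ⟨b, hb, hab⟩ := generatedAnqie_le hB a.2
  obtain rfl : b = a := Subtype.ext hab
  exact hb 0

theorem generatorOrbit_eval (f : LInfty) (n j : ℕ) :
    generatorOrbit f ((generatedAnqie {f}).eval n) j = f (n + j) :=
  Anqie.shiftHom_iterate_apply _ _ _ _

theorem generatorOrbit_addMap_iterate (f : LInfty) (ρ : (generatedAnqie {f}).Spectrum) (i j : ℕ) :
    generatorOrbit f ((generatedAnqie {f}).addMap^[i] ρ) j = generatorOrbit f ρ (i + j) := by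
  rw [generatorOrbit, Anqie.addMap_iterate_apply, ← Function.iterate_add_apply]
  rfl

/-- A Lebesgue number for an open cover of the maximal ideal space. -/
theorem exists_lebesgue_number (f : LInfty) {𝒰 : Set (Set (generatedAnqie {f}).Spectrum)}
    (ho : ∀ U ∈ 𝒰, IsOpen U) (h𝒰 : ⋃₀ 𝒰 = Set.univ) :
    ∃ (J : ℕ) (ε : ℝ), 0 < ε ∧ ∀ ρ, ∃ U ∈ 𝒰, ∀ ρ',
      (∀ j < J, dist (generatorOrbit f ρ j) (generatorOrbit f ρ' j) < ε) → ρ' ∈ U := by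
  have hemb := (continuous_generatorOrbit f).isClosedEmbedding (generatorOrbit_injective f)
  choose W hWo hW using fun U : 𝒰 => hemb.isInducing.isOpen_iff.mp (ho U U.2)
  obtain ⟨V, hV, hVW⟩ := lebesgue_number_lemma (U := W) (isCompact_range hemb.continuous) hWo (by
    rintro _ ⟨ρ, rfl⟩
    obtain ⟨U, hU, hρ⟩ := Set.mem_sUnion.mp (h𝒰 ▸ Set.mem_univ ρ)
    rw [← show _ = U from hW ⟨U, hU⟩] at hρ
    exact Set.mem_iUnion.mpr ⟨_, hρ⟩)
  -- An entourage of the product uniformity restricts only finitely many coordinates; `J` bounds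
  -- their indices and `ε` lies below all their radii.
  rw [Pi.uniformity] at hV
  obtain ⟨⟨I, e⟩, ⟨hI, he⟩, hIV⟩ := (HasBasis.iInf' fun j : ℕ =>
    (Metric.uniformity_basis_dist (α := ℂ)).comap
      fun a : (ℕ → ℂ) × (ℕ → ℂ) => (a.1 j, a.2 j)).mem_iff.mp hV
  obtain ⟨J, hJ⟩ := hI.bddAbove
  obtain ⟨ε, hεe, hε⟩ := (((eventually_all_finite hI).mpr fun j hj =>
    Ioo_mem_nhdsGT (he j hj)).and (self_mem_nhdsWithin (a := (0 : ℝ)))).exists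
  refine ⟨J + 1, ε, hε, fun ρ => ?_⟩
  obtain ⟨U, hU⟩ := hVW _ ⟨ρ, rfl⟩
  refine ⟨U, U.2, fun ρ' h => ?_⟩
  rw [← hW U]
  refine hU (hIV ?_)
  simp only [Set.mem_iInter]
  exact fun j hj => (h j (Nat.lt_succ_of_le (hJ hj))).trans (hεe j hj).2

/-- Cover the spectrum by the sets where `ρ f` lies in a given ball of radius `ε / 2`. A member of
the iterated cover confines a whole word of `f` to within `ε`, so a minimal subcover serves as the
set of colours. -/
theorem zeroEntropy_of_anqieEntropy_eq_zero {f : LInfty} (h : anqieEntropy f = 0) :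
    ZeroEntropy f := by
  intro ε hε η hη
  let A : Anqie := generatedAnqie {f}
  let B : ℂ → Set A.Spectrum := fun z => {ρ | dist (generatorOrbit f ρ 0) z < ε / 2}
  have ho : ∀ U ∈ Set.range B, IsOpen U := by
    rintro _ ⟨z, rfl⟩
    exact isOpen_lt (((continuous_apply 0).comp (continuous_generatorOrbit f)).dist
      continuous_const) continuous_const
  have hB : ⋃₀ Set.range B = Set.univ := Set.eq_univ_of_forall fun ρ =>
    ⟨_, ⟨generatorOrbit f ρ 0, rfl⟩, by simpa [B] using hε⟩
  have hle : coverEntropy A.addMap (Set.range B) ≤ 0 :=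
    (le_iSup₂ (f := fun 𝒰 (_ : 𝒰 ∈ {𝒰 : Set (Set A.Spectrum) | (∀ U ∈ 𝒰, IsOpen U) ∧
      ⋃₀ 𝒰 = Set.univ}) => coverEntropy A.addMap 𝒰) (Set.range B) ⟨ho, hB⟩).trans_eq h
  filter_upwards [eventually_of_coverEntropy_le hle hη] with m hm
  obtain ⟨s, hs, hcov, hcard⟩ := exists_card_eq_coverNumber A.addMap ho hB m
  have hV : ∀ n, ∃ V : s, A.eval n ∈ V.1 := fun n => by
    obtain ⟨V, hV, hn⟩ := Set.mem_sUnion.mp (hcov ▸ Set.mem_univ (A.eval n))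
    exact ⟨⟨V, hV⟩, hn⟩
  choose V hV using hV
  have hcol : IsWordColoring f ε m V := by
    intro n n' hn i hi
    obtain ⟨U, hU, hVU⟩ := hs (V n).2
    obtain ⟨z, hz⟩ := hU ⟨i, hi⟩
    have key : ∀ n, A.eval n ∈ ⋂ i : Fin m, A.addMap^[i] ⁻¹' U i → dist (f (n + i)) z < ε / 2 := by
      intro n hn
      have : A.addMap^[i] (A.eval n) ∈ U ⟨i, hi⟩ := Set.mem_iInter.mp hn ⟨i, hi⟩
      rw [← hz, A.addMap_iterate_eval] at this
      exact this
    have h1 := key n (hVU ▸ hV n)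
    have h2 := key n' (hVU ▸ hn ▸ hV n')
    linarith [dist_triangle_right (f (n + i)) (f (n' + i)) z]
  exact hcol.exists_fin (by rwa [Fintype.card_coe, hcard])

theorem anqieEntropy_eq_zero_of_zeroEntropy {f : LInfty} (h : ZeroEntropy f) :
    anqieEntropy f = 0 := by
  refine le_antisymm (iSup₂_le fun 𝒰 ⟨ho, h𝒰⟩ => coverEntropy_le_of_eventually fun η hη => ?_)
    (topEntropy_nonneg _)
  let A : Anqie := generatedAnqie {f}
  obtain ⟨J, ε, hε, hL⟩ := exists_lebesgue_number f ho h𝒰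
  -- The Lebesgue number looks `J` coordinates ahead, so words of length `m + J` are coloured; the
  -- rate `η / 2` absorbs this because `J ≤ m`. Half of `ε` goes to the colouring and half to
  -- approximating a state by a point evaluation.
  filter_upwards [(tendsto_add_atTop_nat J).eventually (h (ε / 2) (half_pos hε) (η / 2)
    (half_pos hη)), eventually_ge_atTop J] with m ⟨C, hC, c, hc⟩ hm
  choose U hU hUL using hL
  let r : Fin C → ℕ := Function.invFun c
  have hr : ∀ n, c (r (c n)) = c n := fun n => Function.invFun_eq ⟨n, rfl⟩
  let V : Fin C → Set A.Spectrum := fun x =>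
    ⋂ i : Fin m, A.addMap^[i] ⁻¹' U (A.eval (r x + i))
  classical
  have hle : coverNumber (iteratedCover A.addMap 𝒰 m) ≤ C := by
    suffices h : coverNumber (iteratedCover A.addMap 𝒰 m) ≤ (Finset.univ.image V).card from
      h.trans (Finset.card_image_le.trans_eq (by simp))
    refine Nat.sInf_le ⟨Finset.univ.image V, ?_, ?_, rfl⟩
    · intro W hW
      obtain ⟨x, -, rfl⟩ := Finset.mem_image.mp (Finset.mem_coe.mp hW)
      exact ⟨fun i => U (A.eval (r x + i)), fun i => hU _, rfl⟩
    · refine Set.eq_univ_of_forall fun ρ => ?_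
      obtain ⟨n, hn⟩ := A.exists_eval_near ρ
        (fun j : Fin (m + J) => A.shiftHom^[j] (anqieGenerator f)) (half_pos hε)
      refine ⟨V (c n), by simp, Set.mem_iInter.mpr fun i => hUL _ _ fun j hj => ?_⟩
      rw [generatorOrbit_addMap_iterate, generatorOrbit_eval, add_assoc]
      have hij : (i : ℕ) + j < m + J := by omega
      have h1 := hc _ _ (hr n) _ hij
      have h2 : dist (f (n + (i + j))) (generatorOrbit f ρ (i + j)) < ε / 2 := by
        rw [← generatorOrbit_eval]
        exact hn ⟨_, hij⟩
      linarith [dist_triangle (f (r (c n) + (i + j))) (f (n + (i + j)))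
        (generatorOrbit f ρ (i + j))]
  have hm' : (J : ℝ) ≤ m := by exact_mod_cast hm
  refine ((Nat.cast_le.mpr hle).trans hC).trans (Real.exp_le_exp.mpr ?_)
  push_cast
  nlinarith

theorem anqieEntropy_eq_zero_iff {f : LInfty} : anqieEntropy f = 0 ↔ ZeroEntropy f :=
  ⟨zeroEntropy_of_anqieEntropy_eq_zero, anqieEntropy_eq_zero_of_zeroEntropy⟩

/-! ### Complex projections -/

section ComplexMatrix

open scoped ComplexOrder

variable {m n : Type*} [Fintype m] [Fintype n]

/-- A complex projection matrix is `V Vᴴ` for a matrix `V` with orthonormal columns. -/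
theorem exists_isometry_of_isStarProjection [DecidableEq m] {p : Matrix m m ℂ}
    (hp : IsStarProjection p) :
    ∃ (r : ℕ) (V : Matrix m (Fin r) ℂ), V * Vᴴ = p ∧ Vᴴ * V = 1 := by
  have hH : p.IsHermitian := hp.isSelfAdjoint
  let U : Matrix m m ℂ := hH.eigenvectorUnitary
  have hUU : Uᴴ * U = 1 := Unitary.star_mul_self_of_mem hH.eigenvectorUnitary.2
  have hpU : p = U * Matrix.diagonal (fun i => (hH.eigenvalues i : ℂ)) * Uᴴ := by
    conv_lhs => rw [hH.spectral_theorem]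
    rfl
  have h01 : ∀ i, hH.eigenvalues i ≠ 0 → hH.eigenvalues i = 1 := fun i h =>
    (hp.isIdempotentElem.spectrum_subset ℝ (hH.eigenvalues_mem_spectrum_real i)).resolve_left h
  let ι := {i // hH.eigenvalues i ≠ 0}
  let e := (Fintype.equivFin ι).symm
  refine ⟨Fintype.card ι, U.submatrix id fun j => (e j).1, ?_, ?_⟩
  · ext a b
    refine Eq.trans ?_ (congrFun (congrFun hpU a) b).symm
    rw [Matrix.mul_apply, Matrix.mul_apply]
    simp only [Matrix.mul_diagonal, Matrix.submatrix_apply, Matrix.conjTranspose_apply, id]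
    refine (Equiv.sum_comp e fun i : ι => U a i * star (U b i)).trans ?_
    rw [← Finset.sum_subtype (Finset.univ.filter fun i => hH.eigenvalues i ≠ 0) (by simp)
      fun i => U a i * star (U b i), Finset.sum_filter]
    refine Finset.sum_congr rfl fun i _ => ?_
    split_ifs with hi
    · rw [h01 i hi]; simp
    · rw [not_not.mp hi]; simp
  · ext a b
    have := congrFun (congrFun hUU (e a).1) (e b).1
    rw [Matrix.one_apply] at this ⊢
    simpa [Matrix.mul_apply, Subtype.val_injective.eq_iff] using this

theorem exists_trace_eq_natCast [DecidableEq m] {p : Matrix m m ℂ} (hp : IsStarProjection p) :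
    ∃ r : ℕ, p.trace = r := by
  obtain ⟨r, V, rfl, hV⟩ := exists_isometry_of_isStarProjection hp
  exact ⟨r, by rw [Matrix.trace_mul_comm, hV, Matrix.trace_one, Fintype.card_fin]⟩

/-- Complex projections of equal trace are Murray–von Neumann equivalent. -/
theorem mvN_of_trace_eq [DecidableEq m] [DecidableEq n] {p : Matrix m m ℂ} {q : Matrix n n ℂ}
    (hp : IsStarProjection p) (hq : IsStarProjection q) (h : p.trace = q.trace) : MvN p q := by
  obtain ⟨r, V, rfl, hV⟩ := exists_isometry_of_isStarProjection hp
  obtain ⟨r', W, rfl, hW⟩ := exists_isometry_of_isStarProjection hq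
  rw [Matrix.trace_mul_comm, hV, Matrix.trace_mul_comm, hW, Matrix.trace_one, Matrix.trace_one,
    Fintype.card_fin, Fintype.card_fin, Nat.cast_inj] at h
  subst h
  refine ⟨W * Vᴴ, ?_, ?_⟩
  · rw [Matrix.conjTranspose_mul, Matrix.conjTranspose_conjTranspose, Matrix.mul_assoc,
      ← Matrix.mul_assoc Wᴴ, hW, Matrix.one_mul]
  · rw [Matrix.conjTranspose_mul, Matrix.conjTranspose_conjTranspose, Matrix.mul_assoc,
      ← Matrix.mul_assoc Vᴴ, hV, Matrix.one_mul]

/-- A partial isometry from `p` into `q` is onto `q` when the traces agree. -/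
theorem mul_conjTranspose_eq_of_trace_eq {p : Matrix m m ℂ} {q : Matrix n n ℂ}
    {u : Matrix n m ℂ} (hq : IsStarProjection q) (h : p.trace = q.trace)
    (hu : uᴴ * u = p) (hup : u * p = u) (hqu : q * u = u) : u * uᴴ = q := by
  have hqH : qᴴ = q := hq.isSelfAdjoint
  have hqq : q * q = q := hq.isIdempotentElem
  have h1 : u * uᴴ * (u * uᴴ) = u * uᴴ := by
    rw [Matrix.mul_assoc, ← Matrix.mul_assoc uᴴ, hu, ← Matrix.mul_assoc, hup]
  have h2 : q * (u * uᴴ) = u * uᴴ := by rw [← Matrix.mul_assoc, hqu]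
  have h3 : u * uᴴ * q = u * uᴴ := by
    have := congrArg Matrix.conjTranspose h2
    simpa [Matrix.conjTranspose_mul, hqH] using this
  -- The defect `q - u uᴴ` is a projection of trace zero, hence zero.
  have h4 : (q - u * uᴴ)ᴴ * (q - u * uᴴ) = q - u * uᴴ := by
    rw [Matrix.conjTranspose_sub, hqH, Matrix.conjTranspose_mul, Matrix.conjTranspose_conjTranspose,
      Matrix.sub_mul, Matrix.mul_sub, Matrix.mul_sub, hqq, h1, h2, h3]
    simp
  have h5 : ((q - u * uᴴ)ᴴ * (q - u * uᴴ)).trace = 0 := by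
    rw [h4, Matrix.trace_sub, Matrix.trace_mul_comm, hu, h, sub_self]
  exact (sub_eq_zero.mp (Matrix.trace_conjTranspose_mul_self_eq_zero_iff.mp h5)).symm

end ComplexMatrix

/-! ### Inverse square roots near the identity -/

section InvSqrt

variable {B : Type*} [CStarAlgebra B]

/-- The inverse square root, through the functional calculus. -/
def invSqrt (a : B) : B := cfc (fun t : ℝ => (√t)⁻¹) a

theorem spectrum_subset_of_norm_sub_one_le {a : B} (h : ‖a - 1‖ ≤ 1 / 2) :
    spectrum ℝ a ⊆ Set.Icc (1 / 2) (3 / 2) := by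
  intro t ht
  have h1 : t - 1 ∈ spectrum ℝ (a - 1) := by
    simpa using (spectrum.sub_singleton_eq (a := a) (r := (1 : ℝ))).subset ⟨t, ht, 1, rfl, rfl⟩
  have h2 := spectrum.norm_le_norm_mul_of_mem h1
  -- Only an inequality, since `B` may be the zero algebra.
  have h3 : ‖(1 : B)‖ ≤ 1 := IsStarProjection.norm_le _ (.one B)
  have h4 : |t - 1| ≤ 1 / 2 := h2.trans
    ((mul_le_of_le_one_right (norm_nonneg _) h3).trans h)
  rw [abs_le] at h4
  constructor <;> linarith

theorem continuousOn_inv_sqrt_Icc :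
    ContinuousOn (fun t : ℝ => (√t)⁻¹) (Set.Icc (1 / 2) (3 / 2)) :=
  Real.continuous_sqrt.continuousOn.inv₀ fun t ht =>
    (Real.sqrt_pos.mpr (by linarith [ht.1])).ne'

theorem invSqrt_mul_mul_invSqrt {a : B} (ha : IsSelfAdjoint a) (h : ‖a - 1‖ ≤ 1 / 2) :
    invSqrt a * a * invSqrt a = 1 := by
  have hs := spectrum_subset_of_norm_sub_one_le h
  have hc := continuousOn_inv_sqrt_Icc.mono hs
  calc invSqrt a * a * invSqrt a
      = cfc (fun t : ℝ => (√t)⁻¹) a * cfc (id : ℝ → ℝ) a * cfc (fun t : ℝ => (√t)⁻¹) a := by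
        rw [cfc_id ℝ a]; rfl
    _ = cfc (fun t : ℝ => (√t)⁻¹ * id t * (√t)⁻¹) a := by
        rw [← cfc_mul _ _ a hc continuousOn_id,
          ← cfc_mul (fun t => (√t)⁻¹ * id t) _ a (hc.mul continuousOn_id) hc]
    _ = cfc (1 : ℝ → ℝ) a := ?_
    _ = 1 := cfc_one ℝ a
  refine cfc_congr fun t ht => ?_
  have ht0 : 0 < t := by linarith [(hs ht).1]
  have := Real.mul_self_sqrt ht0.le
  have h0 : √t ≠ 0 := (Real.sqrt_pos.mpr ht0).ne'
  simp only [id, Pi.one_apply]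
  field_simp
  rw [sq, this]

theorem isSelfAdjoint_invSqrt (a : B) : IsSelfAdjoint (invSqrt a) := cfc_predicate _ a

theorem commute_invSqrt {a b : B} (h : Commute a b) : Commute (invSqrt a) b := h.cfc_real _

/-- All the spectra lie in one compact interval on which `(√t)⁻¹` is continuous, so the functional
calculus is continuous in the element. -/
theorem continuousOn_invSqrt :
    ContinuousOn (invSqrt : B → B) {a | IsSelfAdjoint a ∧ ‖a - 1‖ ≤ 1 / 2} :=
  (continuousOn_cfc B isCompact_Icc _ continuousOn_inv_sqrt_Icc).mono
    fun _ ha => ⟨ha.1, spectrum_subset_of_norm_sub_one_le ha.2⟩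

end InvSqrt

/-! ### Perturbation of partial isometries -/

section Perturbation

open scoped Matrix.Norms.L2Operator

variable {m n : Type*} [Fintype m] [Fintype n] [DecidableEq m]

/-- `x* x + (1 - p)` for `x = q w p`. -/
def cornerGram (p : Matrix m m ℂ) (q : Matrix n n ℂ) (w : Matrix n m ℂ) : Matrix m m ℂ :=
  p * wᴴ * q * w * p + (1 - p)

theorem isSelfAdjoint_cornerGram {p : Matrix m m ℂ} {q : Matrix n n ℂ}
    (hp : IsStarProjection p) (hq : IsStarProjection q) (w : Matrix n m ℂ) :
    IsSelfAdjoint (cornerGram p q w) := by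
  have hpH : pᴴ = p := hp.isSelfAdjoint
  have hqH : qᴴ = q := hq.isSelfAdjoint
  change (cornerGram p q w)ᴴ = _
  simp [cornerGram, Matrix.conjTranspose_mul, hpH, hqH, Matrix.mul_assoc]

/-- If `p` and `q` were `p₀` and `q₀`, the corner Gram matrix would be `1`. As `wᴴ q₀ w = p₀`, the
deviation is `p wᴴ (q - q₀) w p - p (p - p₀) p`, where all outer factors are contractions. -/
theorem norm_cornerGram_sub_one_le [DecidableEq n] {p p₀ : Matrix m m ℂ} {q q₀ : Matrix n n ℂ}
    {w : Matrix n m ℂ} (hp : IsStarProjection p) (hp₀ : IsStarProjection p₀)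
    (hw : wᴴ * w = p₀) (hw' : w * wᴴ = q₀) :
    ‖cornerGram p q w - 1‖ ≤ ‖p - p₀‖ + ‖q - q₀‖ := by
  have hpp : p * p = p := hp.isIdempotentElem
  have hpp₀ : p₀ * p₀ = p₀ := hp₀.isIdempotentElem
  have hp1 : ‖p‖ ≤ 1 := IsStarProjection.norm_le _ hp
  have hw1 : ‖w‖ ≤ 1 := by
    have := Matrix.l2_opNorm_conjTranspose_mul_self w
    rw [hw] at this
    have h1 : ‖p₀‖ ≤ 1 := IsStarProjection.norm_le _ hp₀
    nlinarith [norm_nonneg w]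
  have hw2 : ‖wᴴ‖ ≤ 1 := by rwa [Matrix.l2_opNorm_conjTranspose]
  have key : cornerGram p q w - 1 = p * wᴴ * (q - q₀) * w * p - p * (p - p₀) * p := by
    have e : wᴴ * q₀ * w = p₀ := by
      rw [← hw', ← Matrix.mul_assoc, hw, Matrix.mul_assoc, hw, hpp₀]
    have e' : p * wᴴ * q₀ * w * p = p * p₀ * p := by
      rw [← e]; simp only [Matrix.mul_assoc]
    rw [cornerGram, Matrix.mul_sub, Matrix.sub_mul, Matrix.sub_mul, e', Matrix.mul_sub,
      Matrix.sub_mul, hpp, hpp]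
    abel
  have h1 : ‖p * wᴴ * (q - q₀) * w * p‖ ≤ ‖q - q₀‖ := by
    calc ‖p * wᴴ * (q - q₀) * w * p‖ ≤ ‖p‖ * ‖wᴴ‖ * ‖q - q₀‖ * ‖w‖ * ‖p‖ := by
          refine (Matrix.l2_opNorm_mul _ _).trans ?_
          gcongr
          refine (Matrix.l2_opNorm_mul _ _).trans ?_
          gcongr
          refine (Matrix.l2_opNorm_mul _ _).trans ?_
          gcongr
          exact Matrix.l2_opNorm_mul _ _
      _ ≤ 1 * 1 * ‖q - q₀‖ * 1 * 1 := by gcongr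
      _ = ‖q - q₀‖ := by ring
  have h2 : ‖p * (p - p₀) * p‖ ≤ ‖p - p₀‖ := by
    calc ‖p * (p - p₀) * p‖ ≤ ‖p‖ * ‖p - p₀‖ * ‖p‖ := by
          refine (Matrix.l2_opNorm_mul _ _).trans ?_
          gcongr
          exact Matrix.l2_opNorm_mul _ _
      _ ≤ 1 * ‖p - p₀‖ * 1 := by gcongr
      _ = ‖p - p₀‖ := by ring
  rw [key]
  refine (norm_sub_le _ _).trans ?_
  linarith

/-- The polar part of `q w p`. -/
def polarPart (p : Matrix m m ℂ) (q : Matrix n n ℂ) (w : Matrix n m ℂ) : Matrix n m ℂ :=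
  q * w * p * invSqrt (cornerGram p q w)

/-- With `x = q w p` and `y` the Gram matrix, `xᴴ x = y p`. The summand `1 - p` makes `y` invertible
in the full matrix algebra, and `y` commutes with `p`, so `x y^(-1/2)` has initial projection `p`.
Equality of traces makes its final projection all of `q`. -/
theorem polarPart_spec {p : Matrix m m ℂ} {q : Matrix n n ℂ} {w : Matrix n m ℂ}
    (hp : IsStarProjection p) (hq : IsStarProjection q) (h : p.trace = q.trace)
    (hn : ‖cornerGram p q w - 1‖ ≤ 1 / 2) :
    (polarPart p q w)ᴴ * polarPart p q w = p ∧ polarPart p q w * (polarPart p q w)ᴴ = q := by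
  have hpH : pᴴ = p := hp.isSelfAdjoint
  have hqH : qᴴ = q := hq.isSelfAdjoint
  have hpp : p * p = p := hp.isIdempotentElem
  have hqq : q * q = q := hq.isIdempotentElem
  set y := cornerGram p q w with hy
  set s := invSqrt y with hs
  have hpy : p * y = p * wᴴ * q * w * p := by
    rw [hy, cornerGram, Matrix.mul_add, Matrix.mul_sub, hpp, Matrix.mul_one, sub_self, add_zero]
    simp only [← Matrix.mul_assoc, hpp]
  have hyp : y * p = p * wᴴ * q * w * p := by
    rw [hy, cornerGram, Matrix.add_mul, Matrix.sub_mul, hpp, Matrix.one_mul, sub_self, add_zero]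
    simp only [Matrix.mul_assoc, hpp]
  have hsp : s * p = p * s := commute_invSqrt (show Commute y p from hyp.trans hpy.symm)
  have hsH : sᴴ = s := isSelfAdjoint_invSqrt y
  have hsys : s * y * s = 1 := invSqrt_mul_mul_invSqrt (isSelfAdjoint_cornerGram hp hq w) hn
  have h1 : (polarPart p q w)ᴴ * polarPart p q w = p := by
    calc (polarPart p q w)ᴴ * polarPart p q w = s * (p * wᴴ * (q * q) * w * p) * s := by
          simp only [polarPart, Matrix.conjTranspose_mul, hpH, hqH, ← hy, ← hs, hsH,
            Matrix.mul_assoc]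
      _ = s * y * s * p := by
          rw [hqq, ← hyp, Matrix.mul_assoc, Matrix.mul_assoc, ← hsp]
          simp only [Matrix.mul_assoc]
      _ = p := by rw [hsys, Matrix.one_mul]
  refine ⟨h1, mul_conjTranspose_eq_of_trace_eq hq h h1 ?_ ?_⟩
  · rw [polarPart, ← hy, ← hs, Matrix.mul_assoc, hsp, ← Matrix.mul_assoc, Matrix.mul_assoc _ p p,
      hpp]
  · simp only [polarPart, ← Matrix.mul_assoc, hqq]

end Perturbation

/-! ### The algebra of functions of zero entropy -/

/-- The bounded arithmetic functions of zero entropy. -/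
def zeroEntropyAlgebra : StarSubalgebra ℂ LInfty where
  carrier := {f | ZeroEntropy f}
  mul_mem' hf hg := (ZeroEntropy.prodMk hf hg).comp_continuous continuous_mul
  add_mem' hf hg := (ZeroEntropy.prodMk hf hg).comp_continuous continuous_add
  algebraMap_mem' z := zeroEntropy_const z
  star_mem' hf := ZeroEntropy.comp_continuous hf continuous_star

theorem coe_zeroEntropyAlgebra :
    (zeroEntropyAlgebra : Set LInfty) = {f | anqieEntropy f = 0} :=
  Set.ext fun _ => anqieEntropy_eq_zero_iff.symm

theorem isClosed_zeroEntropyAlgebra : IsClosed (zeroEntropyAlgebra : Set LInfty) := by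
  refine isClosed_of_closure_subset fun f hf =>
    zeroEntropy_of_forall_exists_dist_lt fun ε hε => ?_
  obtain ⟨g, hg, hd⟩ := Metric.mem_closure_iff.mp hf ε hε
  exact ⟨g, hg, fun n => (BoundedContinuousFunction.dist_coe_le_dist n).trans_lt hd⟩

namespace zeroEntropyAlgebra

theorem exists_of_zeroEntropy {f : ℕ → ℂ} (hf : ZeroEntropy f) :
    ∃ a : zeroEntropyAlgebra, ∀ n, (a : LInfty) n = f n := by
  obtain ⟨C, hC⟩ := hf.isBounded_range.exists_norm_le
  exact ⟨⟨BoundedContinuousFunction.ofNormedAddCommGroup f continuous_of_discreteTopology C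
    fun n => hC _ ⟨n, rfl⟩, hf⟩, fun n => rfl⟩

/-- The evaluation at `n`. -/
def evalAt (n : ℕ) : zeroEntropyAlgebra →⋆ₐ[ℂ] ℂ where
  toFun f := (f : LInfty) n
  map_one' := rfl
  map_mul' _ _ := rfl
  map_zero' := rfl
  map_add' _ _ := rfl
  commutes' _ := rfl
  map_star' _ := rfl

theorem ext_evalAt {a b : zeroEntropyAlgebra} (h : ∀ n, evalAt n a = evalAt n b) : a = b :=
  Subtype.ext (BoundedContinuousFunction.ext h)

/-! ### Matrices over the functions of zero entropy -/

section Matrices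

variable {l m n : Type*}

theorem matrix_ext_evalAt {M N : Matrix m n zeroEntropyAlgebra}
    (h : ∀ k, M.map (evalAt k) = N.map (evalAt k)) : M = N := by
  ext1 i j
  exact ext_evalAt fun k => congrFun (congrFun (h k) i) j

theorem map_evalAt_mul [Fintype m] (k : ℕ) (M : Matrix l m zeroEntropyAlgebra)
    (N : Matrix m n zeroEntropyAlgebra) :
    (M * N).map (evalAt k) = M.map (evalAt k) * N.map (evalAt k) := by
  ext i j
  simp [Matrix.mul_apply]

theorem map_evalAt_conjTranspose (k : ℕ) (M : Matrix m n zeroEntropyAlgebra) :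
    Mᴴ.map (evalAt k) = (M.map (evalAt k))ᴴ := by
  ext i j
  exact map_star (evalAt k) (M j i)

variable [Fintype m]

theorem map_evalAt_trace (k : ℕ) (M : Matrix m m zeroEntropyAlgebra) :
    (M.map (evalAt k)).trace = evalAt k M.trace := by
  simp [Matrix.trace]

theorem isStarProjection_map_evalAt {p : Matrix m m zeroEntropyAlgebra} (hp : IsStarProjection p)
    (k : ℕ) : IsStarProjection (p.map (evalAt k)) := by
  have h1 : p * p = p := hp.isIdempotentElem
  have h2 : pᴴ = p := hp.isSelfAdjoint
  refine ⟨?_, ?_⟩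
  · change _ * _ = _
    rw [← map_evalAt_mul, h1]
  · change (_)ᴴ = _
    rw [← map_evalAt_conjTranspose, h2]

open scoped Matrix.Norms.L2Operator

variable [Fintype n]

theorem zeroEntropy_map_evalAt (M : Matrix m n zeroEntropyAlgebra) [DecidableEq n] :
    ZeroEntropy fun k => M.map (evalAt k) :=
  (ZeroEntropy.pi fun i => ZeroEntropy.pi fun j => (M i j).2).comp_continuous
    -- The operator norm induces the product topology, so the identity is continuous and only the
    -- metric changes.
    (Φ := fun x : m → n → ℂ => (Matrix.of x : Matrix m n ℂ)) continuous_id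

theorem exists_matrix_of_zeroEntropy [DecidableEq n] {u : ℕ → Matrix m n ℂ} (hu : ZeroEntropy u) :
    ∃ M : Matrix m n zeroEntropyAlgebra, ∀ k, M.map (evalAt k) = u k := by
  have := FiniteDimensional.proper_rclike ℂ (Matrix m n ℂ)
  have h : ∀ i j, ZeroEntropy fun k => u k i j := fun i j =>
    hu.comp_continuous (Φ := fun M : Matrix m n ℂ => M i j) (continuous_id.matrix_elem i j)
  choose a ha using fun i j => exists_of_zeroEntropy (h i j)
  exact ⟨Matrix.of a, fun k => by ext i j; exact ha i j k⟩

/-- Projections over the functions of zero entropy are determined up to equivalence by their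
trace. -/
theorem mvN_of_trace_eq [DecidableEq m] [DecidableEq n] {p : Matrix m m zeroEntropyAlgebra}
    {q : Matrix n n zeroEntropyAlgebra} (hp : IsStarProjection p) (hq : IsStarProjection q)
    (h : p.trace = q.trace) : MvN p q := by
  let P : ℕ → Matrix m m ℂ := fun k => p.map (evalAt k)
  let Q : ℕ → Matrix n n ℂ := fun k => q.map (evalAt k)
  have hP : ∀ k, IsStarProjection (P k) := isStarProjection_map_evalAt hp
  have hQ : ∀ k, IsStarProjection (Q k) := isStarProjection_map_evalAt hq
  have htr : ∀ k, (P k).trace = (Q k).trace := fun k => by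
    rw [map_evalAt_trace, map_evalAt_trace, h]
  have hPQ : ZeroEntropy fun k => (P k, Q k) :=
    (zeroEntropy_map_evalAt p).prodMk (zeroEntropy_map_evalAt q)
  -- The errors of `P` and `Q` add up to at most `1 / 2`, the radius within which `invSqrt` is
  -- controlled.
  obtain ⟨g, hg, hd⟩ := hPQ.exists_zeroEntropy_nat (ε := 1 / 4) (by norm_num)
  -- The choice is arbitrary in `k`; only `w ∘ g` is used, whose entropy is controlled by that of
  -- `g`.
  choose w hw hw' using fun k => Arith.mvN_of_trace_eq (hP k) (hQ k) (htr k)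
  have hnear : ∀ k, ‖cornerGram (P k) (Q k) (w (g k)) - 1‖ ≤ 1 / 2 := fun k => by
    refine (norm_cornerGram_sub_one_le (hP k) (hP (g k)) (hw (g k)) (hw' (g k))).trans ?_
    have hk := hd k
    rw [Prod.dist_eq, max_lt_iff, dist_eq_norm, dist_eq_norm] at hk
    linarith [hk.1, hk.2]
  have h1 := FiniteDimensional.proper_rclike ℂ (Matrix m m ℂ)
  have h2 := FiniteDimensional.proper_rclike ℂ (Matrix n n ℂ)
  have h3 := FiniteDimensional.proper_rclike ℂ (Matrix n m ℂ)
  have hT : ZeroEntropy fun k => ((P k, Q k), w (g k)) := hPQ.prodMk (hg.comp_nat w)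
  have hy : ZeroEntropy fun k => cornerGram (P k) (Q k) (w (g k)) :=
    hT.comp_continuous (Φ := fun T => cornerGram T.1.1 T.1.2 T.2) (by
      unfold cornerGram
      fun_prop)
  have hK : IsCompact {a : Matrix m m ℂ | IsSelfAdjoint a ∧ ‖a - 1‖ ≤ 1 / 2} := by
    refine (isCompact_closedBall (1 : Matrix m m ℂ) (1 / 2)).of_isClosed_subset ?_ fun a ha => by
      simpa [dist_eq_norm] using ha.2
    exact (isClosed_eq continuous_star continuous_id).inter
      (isClosed_le (continuous_id.sub continuous_const).norm continuous_const)
  have hs : ZeroEntropy fun k => invSqrt (cornerGram (P k) (Q k) (w (g k))) :=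
    hy.comp_continuousOn hK (fun k => ⟨isSelfAdjoint_cornerGram (hP k) (hQ k) _, hnear k⟩)
      continuousOn_invSqrt
  have hu : ZeroEntropy fun k => polarPart (P k) (Q k) (w (g k)) :=
    (hT.prodMk hs).comp_continuous (Φ := fun T => T.1.1.2 * T.1.2 * T.1.1.1 * T.2) (by fun_prop)
  obtain ⟨u, hu⟩ := exists_matrix_of_zeroEntropy hu
  refine ⟨u, matrix_ext_evalAt fun k => ?_, matrix_ext_evalAt fun k => ?_⟩
  · rw [map_evalAt_mul, map_evalAt_conjTranspose, hu]
    exact (polarPart_spec (hP k) (hQ k) (htr k) (hnear k)).1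
  · rw [map_evalAt_mul, map_evalAt_conjTranspose, hu]
    exact (polarPart_spec (hP k) (hQ k) (htr k) (hnear k)).2

end Matrices

/-! ### The `K₀`-group -/

/-- The pointwise rank of a projection. -/
def traceInt (p : MatrixProjection zeroEntropyAlgebra) : integerValued zeroEntropyAlgebra :=
  ⟨p.mat.trace, fun n => by
    obtain ⟨r, hr⟩ := exists_trace_eq_natCast (isStarProjection_map_evalAt p.isStarProjection n)
    rw [map_evalAt_trace] at hr
    exact ⟨r, by rw [Int.cast_natCast]; exact hr⟩⟩

theorem trace_mul_comm {m n : Type*} [Fintype m] [Fintype n] (M : Matrix m n zeroEntropyAlgebra)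
    (N : Matrix n m zeroEntropyAlgebra) : (M * N).trace = (N * M).trace :=
  ext_evalAt fun k => by
    rw [← map_evalAt_trace, ← map_evalAt_trace, map_evalAt_mul, map_evalAt_mul,
      Matrix.trace_mul_comm]

theorem mvN_iff_trace_eq {p q : MatrixProjection zeroEntropyAlgebra} :
    MvN p.mat q.mat ↔ traceInt p = traceInt q := by
  refine ⟨?_, fun h => mvN_of_trace_eq p.isStarProjection q.isStarProjection
    (congrArg Subtype.val h)⟩
  rintro ⟨u, hp, hq⟩
  refine Subtype.ext ?_
  change p.mat.trace = q.mat.trace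
  rw [← hp, ← hq, trace_mul_comm]

/-- The pointwise rank as a homomorphism on the Murray–von Neumann semigroup. -/
def rank : MvNSemigroup zeroEntropyAlgebra →+ integerValued zeroEntropyAlgebra where
  toFun := Quotient.lift traceInt fun _ _ h => mvN_iff_trace_eq.mp h
  map_zero' := Subtype.ext (Matrix.trace_zero (Fin 1) zeroEntropyAlgebra)
  map_add' a b := by
    induction a using Quotient.inductionOn with | _ p
    induction b using Quotient.inductionOn with | _ q
    refine Subtype.ext ?_
    change (p.diag q).mat.trace = p.mat.trace + q.mat.trace
    refine (Equiv.sum_comp finSumFinEquiv.symm fun i =>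
      Matrix.fromBlocks p.mat 0 0 q.mat i i).trans ?_
    simp [Matrix.trace, Fintype.sum_sum_type]

theorem rank_injective : Function.Injective rank := by
  intro a b h
  induction a using Quotient.inductionOn with | _ p
  induction b using Quotient.inductionOn with | _ q
  exact MvNSemigroup.mk_eq_mk.mpr (mvN_iff_trace_eq.mpr h)

/-- Distinct integers are at distance at least `1`, so values closer than that coincide and `Φ`
needs no continuity. -/
theorem zeroEntropy_comp_int {k : ℕ → ℤ} (hk : ZeroEntropy fun n => (k n : ℂ)) {Y : Type*}
    [PseudoMetricSpace Y] (Φ : ℤ → Y) : ZeroEntropy fun n => Φ (k n) := by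
  refine hk.of_forall_exists fun ε hε => ⟨1, one_pos, fun n n' h => ?_⟩
  have : k n = k n' := by
    rw [dist_eq_norm, ← Int.cast_sub, Complex.norm_intCast] at h
    have h' : |k n - k n'| < 1 := by exact_mod_cast h
    exact sub_eq_zero.mp (Int.abs_lt_one_iff.mp h')
  simpa [this] using hε

/-- The diagonal matrix with entries the indicators of `j < k n` is a projection of trace `k n`;
boundedness of `k` makes its size finite. -/
theorem exists_rank_eq {k : ℕ → ℕ} (hk : ZeroEntropy fun n => (k n : ℂ))
    (a : integerValued zeroEntropyAlgebra) (ha : ∀ n, (a.1 : LInfty) n = k n) :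
    ∃ x, rank x = a := by
  obtain ⟨C, hC⟩ := hk.isBounded_range.exists_norm_le
  obtain ⟨K, hK⟩ := exists_nat_gt C
  have hkK : ∀ n, k n ≤ K + 1 := fun n => by
    have := hC _ ⟨n, rfl⟩
    rw [Complex.norm_natCast] at this
    have h : k n ≤ K := by exact_mod_cast this.trans hK.le
    omega
  have hind : ∀ j : Fin (K + 1), ZeroEntropy fun n => if (j : ℕ) < k n then (1 : ℂ) else 0 :=
    fun j => by
      have := zeroEntropy_comp_int (k := fun n => k n) (by simpa using hk)
        fun z : ℤ => if ((j : ℕ) : ℤ) < z then (1 : ℂ) else 0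
      simpa only [Nat.cast_lt] using this
  choose e he using fun j => exists_of_zeroEntropy (hind j)
  refine ⟨MvNSemigroup.mk ⟨K + 1, Nat.succ_pos K, Matrix.diagonal e, ?_, ?_⟩, ?_⟩
  · change _ * _ = _
    rw [Matrix.diagonal_mul_diagonal]
    congr 1
    funext j
    refine ext_evalAt fun n => ?_
    rw [map_mul]
    change (e j : LInfty) n * (e j : LInfty) n = (e j : LInfty) n
    rw [he]; split_ifs <;> simp
  · change (Matrix.diagonal e)ᴴ = _
    rw [Matrix.diagonal_conjTranspose]
    congr 1
    funext j
    refine ext_evalAt fun n => ?_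
    change star ((e j : LInfty) n) = (e j : LInfty) n
    rw [he]; split_ifs <;> simp
  · refine Subtype.ext (ext_evalAt fun n => ?_)
    change evalAt n (Matrix.diagonal e).trace = _
    rw [Matrix.trace_diagonal, map_sum]
    change ∑ j, (e j : LInfty) n = (a.1 : LInfty) n
    simp only [he, ha]
    rw [Fin.sum_univ_eq_sum_range (fun j => if j < k n then (1 : ℂ) else 0), Finset.sum_boole]
    congr 1
    have : (Finset.range (K + 1)).filter (· < k n) = Finset.range (k n) := by
      ext j
      have := hkK n
      simp only [Finset.mem_filter, Finset.mem_range]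
      omega
    rw [this, Finset.card_range]

theorem exists_rank_sub_rank_eq (a : integerValued zeroEntropyAlgebra) :
    ∃ x y, rank x - rank y = a := by
  choose k hk using a.2
  have hkZ : ZeroEntropy fun n => (k n : ℂ) := by
    have h : ZeroEntropy (a.1 : LInfty) := a.1.2
    rwa [funext hk] at h
  have h1 : ZeroEntropy fun n => (((k n).toNat : ℕ) : ℂ) :=
    zeroEntropy_comp_int hkZ fun z => ((z.toNat : ℕ) : ℂ)
  have h2 : ZeroEntropy fun n => (((-k n).toNat : ℕ) : ℂ) :=
    zeroEntropy_comp_int hkZ fun z => (((-z).toNat : ℕ) : ℂ)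
  obtain ⟨b, hb⟩ := exists_of_zeroEntropy h1
  obtain ⟨c, hc⟩ := exists_of_zeroEntropy h2
  obtain ⟨x, hx⟩ := exists_rank_eq h1 ⟨b, fun n => ⟨_, by rw [hb n, Int.cast_natCast]⟩⟩ hb
  obtain ⟨y, hy⟩ := exists_rank_eq h2 ⟨c, fun n => ⟨_, by rw [hc n, Int.cast_natCast]⟩⟩ hc
  refine ⟨x, y, ?_⟩
  rw [hx, hy]
  refine Subtype.ext (ext_evalAt fun n => ?_)
  change (b : LInfty) n - (c : LInfty) n = (a.1 : LInfty) n
  rw [hb, hc, hk]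
  have := Int.toNat_sub_toNat_neg (k n)
  exact_mod_cast this

end zeroEntropyAlgebra

/-! ### Grothendieck groups of monoids embedded in a group -/

section Grothendieck

open Algebra

variable {M G : Type*} [AddCommMonoid M] [AddCommGroup G]

/-- An injective homomorphism to a group whose differences exhaust the group induces an
isomorphism of the Grothendieck group. -/
theorem nonempty_grothendieckAddGroup_addEquiv (f : M →+ G) (hf : Function.Injective f)
    (hs : ∀ a, ∃ x y, f x - f y = a) : Nonempty (GrothendieckAddGroup M ≃+ G) := by
  have hlift : ∀ x, GrothendieckAddGroup.lift f (GrothendieckAddGroup.of x) = f x := fun x =>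
    DFunLike.congr_fun (GrothendieckAddGroup.lift.symm_apply_apply f) x
  refine ⟨AddEquiv.ofBijective (GrothendieckAddGroup.lift f) ⟨?_, fun a => ?_⟩⟩
  · rw [injective_iff_map_eq_zero]
    intro z hz
    induction z using AddLocalization.ind with | _ z
    obtain ⟨x, y⟩ := z
    -- Every element is a formal difference, so injectivity of `f` on the monoid already gives a
    -- trivial kernel.
    have hxy : AddLocalization.mk x y =
        GrothendieckAddGroup.of x - GrothendieckAddGroup.of (y : M) := by
      simp [← AddLocalization.mk_zero_eq_addMonoidOf_mk]
    rw [hxy, map_sub, hlift, hlift, sub_eq_zero] at hz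
    rw [hxy, hf hz, sub_self]
  · obtain ⟨x, y, rfl⟩ := hs a
    exact ⟨GrothendieckAddGroup.of x - GrothendieckAddGroup.of y, by rw [map_sub, hlift, hlift]⟩

end Grothendieck

end Arith

end

theorem mainTheorem1 :
    ∃ E₀ : StarSubalgebra ℂ Arith.LInfty,
      (E₀ : Set Arith.LInfty) = {f | Arith.anqieEntropy f = 0} ∧
      IsClosed (E₀ : Set Arith.LInfty) ∧
      Nonempty (Arith.KZero E₀ ≃+ Arith.integerValued E₀) := by
  exact ⟨Arith.zeroEntropyAlgebra, Arith.coe_zeroEntropyAlgebra,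
    Arith.isClosed_zeroEntropyAlgebra, Arith.nonempty_grothendieckAddGroup_addEquiv
      Arith.zeroEntropyAlgebra.rank Arith.zeroEntropyAlgebra.rank_injective
      Arith.zeroEntropyAlgebra.exists_rank_sub_rank_eq⟩
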